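/- **Notation.** For a function $f:[0,1]\to[0,\infty)$ let $\mathbf E_f$ be the relation on $[0,1]^\omega$ given by $(x_n)\,\mathbf E_f\,(y_n)\iff\sum_{n<\omega}f(|y_n-x_n|)<\infty$. For relations $E,F$ on Polish spaces $X,Y$, $E\le_B F$ means that there is a Borel map $\theta:X\to Y$ with $x\,E\,y\iff\theta(x)\,F\,\theta(y)$ for all $x,y\in X$; $E<_BF$ means $E\le_BF$ and $F\not\le_BE$. For $U,V\subseteq\omega$, $U\subseteq^*V$ means that $U\setminus V$ is finite; $P(\omega)/\mathrm{Fin}$ is partially ordered by $\subseteq^*$. For $x\in(0,1]$ let $t_0(x)=1-\log_2x$ and $t_{n+1}(x)=1+\log_2 t_n(x)$. For a finite sequence $\eta=(\eta_0,\dots,\eta_{|\eta|-1})\in[0,1)^{<\omega}$ let $l_\eta(x)=\prod_{i<|\eta|}t_i(x)^{\eta_i}$ for $x\in(0,1]$ (so $l_\emptyset\equiv1$); at $x=0$ put $1/l_\eta(0)=0$ if $\eta\ne\emptyset$ and $1/l_\emptyset(0)=1$. Extend finite sequences by zeros, $\eta_j=0$ for $j\ge|\eta|$, and write $\eta<_{lex}\eta'$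 if there is $j$ with $\eta_j<\eta'_j$ and $\eta_i=\eta'_i$ for all $i<j$ (for the extended sequences). Let $a_0=0$, $a_l=a_{l-1}+1+(l-1)a_{l-1}$ for $l>0$, and $I_l=[a_l,a_{l+1})\cap\omega$. Let $k_0(m)=2^{m+1}$ and $k_{i+1}(m)=2^{k_i(m)}$ for $i,m<\omega$. **Theorem.** Let $\alpha\ge1$ and $\eta,\eta'\in[0,1)^{<\omega}$ with $\eta<_{lex}\eta'$. Then $\mathbf E_{\mathrm{Id}^\alpha/l_\eta}$ and $\mathbf E_{\mathrm{Id}^\alpha/l_{\eta'}}$ are Borel equivalence relations, and the following hold. (1) Let $j_0$ be the least $j$ with $\eta_j<\eta'_j$, let $2^{\eta_{j_0}-\eta'_{j_0}}<\delta<1$, and put $k_m=k_{j_0}(m)$. For $U\subseteq\omega$ let $u_U(0)=1$ and, for $n>0$, let $u_U(n)=\delta\,u_U(n-1)$ if $n=k_m$ for some $m\in I_l$ with $l\in U$, and $u_U(n)=u_U(n-1)$ otherwise. For every $U\subseteq\omega$ let $\varphi_U:[0,1]\to[0,\infty)$ be any continuous (weakly) increasing function with $\varphi_U(1/2^n)=u_U(n)$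 for all $n<\omega$, and let $f_U(x)=x^\alpha\varphi_U(x)/l_\eta(x)$ for $x\in[0,1]$. Then every $\mathbf E_{f_U}$ is a Borel equivalence relation, and for all $U,V\subseteq\omega$ $$U\subseteq^*V\iff\mathbf E_{f_U}\le_B\mathbf E_{f_V},\qquad \mathbf E_{\mathrm{Id}^\alpha/l_\eta}\le_B\mathbf E_{f_U}<_B\mathbf E_{\mathrm{Id}^\alpha/l_{\eta'}}.$$ (2) Consequently $P(\omega)/\mathrm{Fin}$ embeds between $\mathbf E_{\mathrm{Id}^\alpha/l_\eta}$ and $\mathbf E_{\mathrm{Id}^\alpha/l_{\eta'}}$: there is a map $e$ from $P(\omega)/\mathrm{Fin}$ to the Borel equivalence relations on $[0,1]^\omega$ such that, for all $p,q\in P(\omega)/\mathrm{Fin}$, $p\le q\iff e(p)\le_Be(q)$, and $\mathbf E_{\mathrm{Id}^\alpha/l_\eta}\le_Be(p)<_B\mathbf E_{\mathrm{Id}^\alpha/l_{\eta'}}$. -/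

import Mathlib

open scoped NNReal unitInterval

noncomputable section

/-- The Borel reduction `E ≤_B F` between binary relations. -/
def BorelReducible {X Y : Type*} [MeasurableSpace X] [MeasurableSpace Y]
    (E : X → X → Prop) (F : Y → Y → Prop) : Prop :=
  ∃ θ : X → Y, Measurable θ ∧ ∀ x y, E x y ↔ F (θ x) (θ y)

/-- The strict Borel reduction `E <_B F`. -/
def StrictBorelReducible {X Y : Type*} [MeasurableSpace X] [MeasurableSpace Y]
    (E : X → X → Prop) (F : Y → Y → Prop) : Prop :=
  BorelReducible E F ∧ ¬ BorelReducible F E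

/-- `E` is a Borel equivalence relation. -/
def IsBorelEquivalence {X : Type*} [MeasurableSpace X] (E : X → X → Prop) : Prop :=
  Equivalence E ∧ MeasurableSet {p : X × X | E p.1 p.2}

/-- Borel equivalence relations on `X`, preordered by Borel reducibility. -/
structure BorelEqRel (X : Type*) [MeasurableSpace X] where
  rel : X → X → Prop
  isBorelEquivalence : IsBorelEquivalence rel

instance {X : Type*} [MeasurableSpace X] : Preorder (BorelEqRel X) where
  le E F := BorelReducible E.rel F.rel
  le_refl _ := ⟨id, measurable_id, fun _ _ => Iff.rfl⟩
  le_trans _ _ _ := fun ⟨θ, hθ, h⟩ ⟨ρ, hρ, h'⟩ =>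
    ⟨ρ ∘ θ, hρ.comp hθ, fun x y => (h x y).trans (h' _ _)⟩

/-- `U ⊆* V`: all but finitely many elements of `U` belong to `V`. -/
def AlmostSubset (U V : Set ℕ) : Prop := (U \ V).Finite

/-- The subsets of `ω`, to be preordered by almost inclusion. -/
structure OmegaSubset where
  carrier : Set ℕ

instance : Preorder OmegaSubset where
  le U V := AlmostSubset U.carrier V.carrier
  le_refl U := by simp [AlmostSubset]
  le_trans U V W hUV hVW := by
    refine (hUV.union hVW).subset fun n hn => ?_
    by_cases h : n ∈ V.carrier
    · exact Or.inr ⟨h, hn.2⟩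
    · exact Or.inl ⟨hn.1, h⟩

/-- `P(ω)/Fin`: subsets of `ω` modulo finite differences, partially ordered by `⊆*`. -/
abbrev PowerModFin : Type := Antisymmetrization OmegaSubset (· ≤ ·)

/-- `|y - x|` as an element of `[0,1]`. -/
def absDiff (x y : I) : I :=
  ⟨|(y : ℝ) - x|, abs_nonneg _, abs_le.2
    ⟨by linarith [x.2.2, y.2.1], by linarith [x.2.1, y.2.2]⟩⟩

/-- The relation `E_f` on `[0,1]^ω`: `∑ f(|y_n - x_n|) < ∞`. -/
def ERel (f : I → ℝ≥0) (x y : ℕ → I) : Prop :=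
  Summable fun n => f (absDiff (x n) (y n))

/-- `t_0(x) = 1 - log₂ x`, `t_{n+1}(x) = 1 + log₂ (t_n(x))`, for `x ∈ (0,1]`. -/
def iterLog : ℕ → ℝ → ℝ
  | 0, x => 1 - Real.logb 2 x
  | n + 1, x => 1 + Real.logb 2 (iterLog n x)

theorem one_le_iterLog (n : ℕ) (x : I) : 1 ≤ iterLog n x := by
  induction n with
  | zero =>
    have := Real.logb_nonpos (b := 2) (by norm_num) x.2.1 x.2.2
    simp only [iterLog]
    linarith
  | succ n ih =>
    have := Real.logb_nonneg (b := 2) (by norm_num) ih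
    simp only [iterLog]
    linarith

/-- The `i`-th entry of a finite sequence extended by zeros. -/
def entry (η : List ℝ) (i : ℕ) : ℝ := η.getD i 0

/-- The weight `l_η(x) = ∏_{i < |η|} t_i(x)^{η_i}`, for `x ∈ (0,1]`. -/
def weight (η : List ℝ) (x : ℝ) : ℝ :=
  ∏ i ∈ Finset.range η.length, iterLog i x ^ entry η i

theorem weight_nonneg (η : List ℝ) (x : I) : 0 ≤ weight η x :=
  Finset.prod_nonneg fun i _ =>
    Real.rpow_nonneg (zero_le_one.trans (one_le_iterLog i x)) _

open Classical in
/-- `1/l_η` on `[0,1]`, where `1/l_∅ ≡ 1` and `1/l_η(0) = 0` for `η ≠ ∅`. -/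
def invWeight (η : List ℝ) (x : I) : ℝ≥0 :=
  if x = 0 then (if η = [] then 1 else 0)
  else ⟨1 / weight η x, one_div_nonneg.2 (weight_nonneg η x)⟩

/-- The function `Id^α` on `[0,1]`. -/
def idPow (α : ℝ) (x : I) : ℝ≥0 := ⟨(x : ℝ) ^ α, Real.rpow_nonneg x.2.1 α⟩

/-- The point `1/2^n` of `[0,1]`. -/
def halfPow (n : ℕ) : I :=
  ⟨1 / 2 ^ n, by positivity, (div_le_one (by positivity)).2 (one_le_pow₀ (by norm_num))⟩

/-- The lexicographical order on finite sequences, both extended by zeros: at the first place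
where the extensions differ, the entry of `η` is the smaller one. -/
def LexLT (η η' : List ℝ) : Prop :=
  ∃ j, (∀ i < j, entry η i = entry η' i) ∧ entry η j < entry η' j

/-- `a_0 = 0` and `a_l = a_{l-1} + 1 + (l-1) a_{l-1}` for `l > 0`. -/
def blockStart : ℕ → ℕ
  | 0 => 0
  | l + 1 => blockStart l + 1 + l * blockStart l

/-- `I_l = [a_l, a_{l+1}) ∩ ω`. -/
def block (l : ℕ) : Set ℕ := Set.Ico (blockStart l) (blockStart (l + 1))

/-- `k_0(m) = 2^{m+1}` and `k_{i+1}(m) = 2^{k_i(m)}`. -/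
def tower : ℕ → ℕ → ℕ
  | 0, m => 2 ^ (m + 1)
  | i + 1, m => 2 ^ tower i m

open Classical in
/-- The sequence `u_U`: `u_U(0) = 1`, and for `n > 0`, `u_U(n) = δ u_U(n-1)` if `n = k_m` for some
`m ∈ I_l` with `l ∈ U`, and `u_U(n) = u_U(n-1)` otherwise. -/
def stepSeq (k : ℕ → ℕ) (δ : ℝ) (U : Set ℕ) : ℕ → ℝ
  | 0 => 1
  | n + 1 =>
    if ∃ l ∈ U, ∃ m ∈ block l, n + 1 = k m then δ * stepSeq k δ U n else stepSeq k δ U n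

/-- The function `Id^α / l_η` on `[0,1]`. -/
def baseFun (α : ℝ) (η : List ℝ) (x : I) : ℝ≥0 := idPow α x * invWeight η x

/-- The function `x^α φ(x) / l_η(x)` on `[0,1]`. -/
def modFun (α : ℝ) (η : List ℝ) (φ : I → ℝ≥0) (x : I) : ℝ≥0 :=
  idPow α x * φ x * invWeight η x

end

open scoped ENNReal Topology
open Filter

/-! All functions in play are gauges (`IsGauge`): `f (t * x) ≤ t * f x`, and `f x * f y ≤ K * f (x *
y)`. For gauges, two criteria reduce Borel reducibility to the growth of `f / g` along the points
`2⁻ⁿ`.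

Sufficiency (`borelReducible_of_almost_increasing`): if `f / g` is, up to a constant factor,
increasing as the argument tends to `0`, then `E_f` reduces to `E_g`. Each coordinate is sent to
sine and cosine waves of amplitude and wavelength about `2⁻ⁱ`, scale `i` being repeated `M i` times
with `∑_{i ≤ n} M i ≈ f(2⁻ⁿ) / g(2⁻ⁿ)`. At distance about `2⁻ⁿ` the scales `i ≤ n` contribute about
`f(2⁻ⁿ)`; the finer scales have saturated and add only a geometric tail.

Necessity (`exists_le_mul_of_borelReducible`): if `E_f` reduces to `E_g`, then `g ≤ C f` at the
points `2⁻ⁿ`. A Baire category fusion makes the reduction act coordinate by coordinate up to a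
summable error (`exists_modular`). If `g / f` is unbounded, choose scales with `∑ f(2⁻ᵘ)` finite and
`∑ g(2⁻ᵘ)` infinite, and cross `[0,1]` in each coordinate by dyadic steps of these sizes. Some step
of each path has an image at least about `g(2⁻ᵘ)` times the displacement of the endpoints
(`IsGauge.exists_step`). As the steps are summable, the endpoint displacements cannot stay away from
`0`; so two inequivalent sequences acquire equivalent images.

What remains is growth estimates. Up to constants `t_j(2⁻ⁿ)` is `2 ^ M n`, where `M n` counts the
`m` with `tower j m ≤ n`, and `u_U(n)` is `δ` to the number of these `m` that lie in blocks indexed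
by `U`. Hence `u_U` decays no faster than `t_j ^ logb 2 δ`, which is slower than `t_j ^ (η_j -
η'_j)`, while the later iterated logarithms cost only small powers of `t_j`. This puts every
`E_{f_U}` strictly below the upper relation. The block `I_l` is so long compared with `a_l` that one
`l` in `U \ V` makes `u_V / u_U` at least `δ ^ (-l)`, and this separates `U` from `V` unless `U ⊆*
V`. -/

/-! ### Dyadic points and distances in the unit interval -/

theorem halfPow_add (m n : ℕ) : halfPow (m + n) = halfPow m * halfPow n := by
  ext; simp [halfPow, pow_add, mul_comm]

theorem halfPow_ne_zero (n : ℕ) : halfPow n ≠ 0 := by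
  intro h
  have := congrArg Subtype.val h
  simp [halfPow] at this

theorem coe_halfPow (n : ℕ) : (halfPow n : ℝ) = 1 / 2 ^ n := rfl

theorem halfPow_antitone : Antitone halfPow := by
  intro m n h
  rw [← Subtype.coe_le_coe, coe_halfPow, coe_halfPow]
  gcongr
  norm_num

theorem exists_halfPow_near {x : I} (hx : x ≠ 0) :
    ∃ n, halfPow (n + 1) ≤ x ∧ x ≤ halfPow n := by
  have h0 : (0 : ℝ) < x := lt_of_le_of_ne x.2.1 (fun h => hx (Subtype.ext h.symm))
  obtain ⟨n, h1, h2⟩ := exists_nat_pow_near_of_lt_one (y := (1 / 2 : ℝ)) h0 x.2.2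
    (by norm_num) (by norm_num)
  refine ⟨n, ?_, ?_⟩ <;> rw [← Subtype.coe_le_coe, coe_halfPow]
  · simpa using h1.le
  · simpa using h2

theorem absDiff_comm (x y : I) : absDiff x y = absDiff y x := by
  ext; simp [absDiff, abs_sub_comm]

theorem absDiff_self (x : I) : absDiff x x = 0 := by ext; simp [absDiff]

theorem continuous_absDiff : Continuous fun p : I × I => absDiff p.1 p.2 := by
  unfold absDiff
  fun_prop

/-! ### Gauges and their equivalence relations -/

/-- Functions `f` on `[0,1]` that are positive away from `0`, star-shaped in the sense that
`f x / x` is increasing, and supermultiplicative up to a constant. -/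
structure IsGauge (f : I → ℝ≥0) : Prop where
  pos : ∀ x, x ≠ 0 → 0 < f x
  star : ∀ t x : I, (f (t * x) : ℝ) ≤ t * f x
  supermul : ∃ K : ℝ≥0, ∀ x y, f x * f y ≤ K * f (x * y)

namespace IsGauge

variable {f : I → ℝ≥0} (hf : IsGauge f)
include hf

theorem map_zero : f 0 = 0 := by
  have := hf.star 0 0
  simp only [mul_zero, Set.Icc.coe_zero, zero_mul] at this
  exact le_antisymm (by exact_mod_cast this) zero_le

theorem le_mul_of_le {x y : I} (h : x ≤ y) (hy : y ≠ 0) : (f x : ℝ) ≤ x / y * f y := by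
  have h0 : (0 : ℝ) < y := lt_of_le_of_ne y.2.1 (fun h => hy (Subtype.ext h.symm))
  have := hf.star ⟨x / y, div_nonneg x.2.1 h0.le, (div_le_one h0).2 h⟩ y
  have e : (⟨x / y, div_nonneg x.2.1 h0.le, (div_le_one h0).2 h⟩ : I) * y = x := by
    ext; simp [h0.ne']
  rwa [e] at this

theorem monotone : Monotone f := by
  intro x y h
  by_cases hy : y = 0
  · subst hy
    rw [le_antisymm h x.2.1]
  · have h1 := hf.le_mul_of_le h hy
    have h0 : (0 : ℝ) < y := lt_of_le_of_ne y.2.1 (fun h => hy (Subtype.ext h.symm))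
    have h2 : (x / y : ℝ) ≤ 1 := (div_le_one h0).2 h
    have : (f x : ℝ) ≤ f y := h1.trans (mul_le_of_le_one_left (f y).2 h2)
    exact_mod_cast this

theorem halfPow_pos (n : ℕ) : 0 < f (halfPow n) := hf.pos _ (halfPow_ne_zero n)

theorem exists_le_mul_halfPow (n : ℕ) : ∃ K : ℝ≥0, ∀ x, f x ≤ K * f (halfPow n * x) := by
  obtain ⟨K, hK⟩ := hf.supermul
  refine ⟨K / f (halfPow n), fun x => ?_⟩
  rw [div_mul_eq_mul_div, le_div_iff₀ (hf.halfPow_pos n), mul_comm]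
  exact hK _ _

theorem halfPow_succ_le (n : ℕ) : f (halfPow (n + 1)) ≤ f (halfPow n) / 2 := by
  have := hf.star (halfPow 1) (halfPow n)
  rw [← halfPow_add, add_comm, coe_halfPow] at this
  rw [← NNReal.coe_le_coe]
  push_cast
  linarith

/-- One of the two intermediate distances is at least half of the total, and halving the argument of
a gauge costs only a constant by supermultiplicativity. -/
theorem exists_quasi_triangle : ∃ K : ℝ≥0, ∀ x y z,
    f (absDiff x z) ≤ K * (f (absDiff x y) + f (absDiff y z)) := by
  obtain ⟨K, hK⟩ := hf.exists_le_mul_halfPow 1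
  refine ⟨K, fun x y z => (hK _).trans ?_⟩
  gcongr
  have key : (halfPow 1 * absDiff x z : I) ≤ absDiff x y ⊔ absDiff y z := by
    rw [le_sup_iff, ← Subtype.coe_le_coe, ← Subtype.coe_le_coe]
    simp only [Set.Icc.coe_mul, coe_halfPow, absDiff]
    have := abs_add_le ((z : ℝ) - y) (y - x)
    rw [sub_add_sub_cancel] at this
    by_contra! h
    linarith
  refine (hf.monotone key).trans ?_
  rcases le_total (absDiff x y) (absDiff y z) with h | h
  · rw [sup_eq_right.2 h]; exact le_add_self
  · rw [sup_eq_left.2 h]; exact le_self_add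

theorem measurable : Measurable f := hf.monotone.measurable

end IsGauge

theorem eRel_iff_tsum_ne_top (f : I → ℝ≥0) (x y : ℕ → I) :
    ERel f x y ↔ ∑' n, (f (absDiff (x n) (y n)) : ℝ≥0∞) ≠ ⊤ :=
  ENNReal.tsum_coe_ne_top_iff_summable.symm

theorem IsGauge.isBorelEquivalence {f : I → ℝ≥0} (hf : IsGauge f) :
    IsBorelEquivalence (ERel f) := by
  refine ⟨⟨fun x => ?_, fun {x y} h => ?_, fun {x y z} h h' => ?_⟩, ?_⟩
  · simp [ERel, absDiff_self, hf.map_zero, summable_zero]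
  · simpa only [ERel, absDiff_comm] using h
  · obtain ⟨K, hK⟩ := hf.exists_quasi_triangle
    exact NNReal.summable_of_le (fun n => hK (x n) (y n) (z n)) ((h.add h').mul_left K)
  · simp only [eRel_iff_tsum_ne_top]
    refine MeasurableSet.compl (measurableSet_eq_fun ?_ measurable_const)
    refine Measurable.tsum fun n => ?_
    have h : Measurable fun p : (ℕ → I) × (ℕ → I) => (p.1 n, p.2 n) := by fun_prop
    exact (hf.measurable.comp (continuous_absDiff.measurable.comp h)).coe_nnreal_ennreal

/-! ### Waves at dyadic scales -/

/-- The wave `x ↦ 2⁻ⁱ (1 + s (2ⁱ x)) / 2` of `[0,1]`, where `s` is the sine or the cosine. -/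
noncomputable def wave (i : ℕ) (b : Bool) (x : I) : I :=
  ⟨1 / 2 ^ i * ((1 + cond b Real.sin Real.cos (2 ^ i * x)) / 2), by
    have h : |cond b Real.sin Real.cos (2 ^ i * x)| ≤ 1 := by
      cases b
      · exact Real.abs_cos_le_one _
      · exact Real.abs_sin_le_one _
    rw [abs_le] at h
    have h1 : (0 : ℝ) < 1 / 2 ^ i := by positivity
    have h2 : (1 : ℝ) / 2 ^ i ≤ 1 := (halfPow i).2.2
    exact ⟨mul_nonneg h1.le (by linarith), mul_le_one₀ h2 (by linarith) (by linarith)⟩⟩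

theorem continuous_wave (i : ℕ) (b : Bool) : Continuous (wave i b) := by
  unfold wave
  cases b <;> · simp only [cond]; fun_prop

theorem coe_absDiff_wave (i : ℕ) (b : Bool) (x y : I) :
    (absDiff (wave i b x) (wave i b y) : ℝ) = 1 / 2 ^ i * (|cond b Real.sin Real.cos (2 ^ i * y) -
      cond b Real.sin Real.cos (2 ^ i * x)| / 2) := by
  have h1 : (0 : ℝ) < 1 / 2 ^ i / 2 := by positivity
  rw [mul_div_assoc', ← div_mul_eq_mul_div, ← abs_of_pos h1, ← abs_mul]
  simp only [absDiff, wave]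
  congr 1
  ring

theorem absDiff_wave_le_halfPow (i : ℕ) (b : Bool) (x y : I) :
    absDiff (wave i b x) (wave i b y) ≤ halfPow i := by
  rw [← Subtype.coe_le_coe, coe_absDiff_wave, coe_halfPow]
  refine mul_le_of_le_one_right (by positivity) ?_
  have h : ∀ t, |cond b Real.sin Real.cos t| ≤ 1 := by
    cases b
    · exact Real.abs_cos_le_one
    · exact Real.abs_sin_le_one
  have := abs_sub (cond b Real.sin Real.cos (2 ^ i * y)) (cond b Real.sin Real.cos (2 ^ i * x))
  linarith [h (2 ^ i * x), h (2 ^ i * y)]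

theorem absDiff_wave_le_absDiff (i : ℕ) (b : Bool) (x y : I) :
    absDiff (wave i b x) (wave i b y) ≤ absDiff x y := by
  have h : |cond b Real.sin Real.cos (2 ^ i * y) - cond b Real.sin Real.cos (2 ^ i * x)| ≤
      |(2 : ℝ) ^ i * y - 2 ^ i * x| := by
    cases b
    · exact Real.abs_cos_sub_cos_le _ _
    · exact Real.abs_sin_sub_sin_le _ _
  rw [← mul_sub, abs_mul, abs_of_pos (by positivity : (0 : ℝ) < 2 ^ i)] at h
  rw [← Subtype.coe_le_coe, coe_absDiff_wave, one_div_mul_eq_div, div_le_iff₀ (by positivity)]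
  simp only [absDiff]
  nlinarith [abs_nonneg ((y : ℝ) - x), (by positivity : (0 : ℝ) < 2 ^ i)]

/-- A single wave is flat at its critical points, but sine and cosine together are not: the squares
of their increments add up to `2 - 2 cos (s - t) ≥ (s - t)² / 4` for `|s - t| ≤ 1`, so one increment
is at least `|s - t| / 4`. The factor `1/2` in `wave` turns this into `1/8`. -/
theorem exists_le_absDiff_wave {i : ℕ} {x y : I} (h : absDiff x y ≤ halfPow i) :
    ∃ b, halfPow 3 * absDiff x y ≤ absDiff (wave i b x) (wave i b y) := by
  set s := (2 : ℝ) ^ i * y with hs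
  set t := (2 : ℝ) ^ i * x with ht
  have hp : (0 : ℝ) < 2 ^ i := by positivity
  have hd : |s - t| = 2 ^ i * (absDiff x y : ℝ) := by
    simp only [hs, ht, absDiff, ← mul_sub, abs_mul, abs_of_pos hp]
  have h1 : |s - t| ≤ 1 := by
    rw [hd, ← le_div_iff₀' hp]
    exact h
  have h2 := Real.cos_le_one_sub_mul_cos_sq (h1.trans (by linarith [Real.pi_gt_three]))
  have h3 : (s - t) ^ 2 / 8 ≤ 2 / Real.pi ^ 2 * (s - t) ^ 2 := by
    rw [div_eq_inv_mul]
    gcongr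
    rw [le_div_iff₀ (by positivity)]
    nlinarith [Real.pi_pos, Real.pi_le_four]
  have h4 : (s - t) ^ 2 / 4 ≤ |Real.sin s - Real.sin t| ^ 2 + |Real.cos s - Real.cos t| ^ 2 := by
    rw [sq_abs, sq_abs]
    rw [Real.cos_sub] at h2
    nlinarith [Real.sin_sq_add_cos_sq s, Real.sin_sq_add_cos_sq t]
  have key : ∃ b, |s - t| / 4 ≤ |cond b Real.sin Real.cos s - cond b Real.sin Real.cos t| := by
    by_contra! hc
    have h5 := hc true
    have h6 := hc false
    simp only [cond] at h5 h6
    have h7 := pow_lt_pow_left₀ h5 (abs_nonneg _) two_ne_zero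
    have h8 := pow_lt_pow_left₀ h6 (abs_nonneg _) two_ne_zero
    rw [div_pow, sq_abs (s - t)] at h7 h8
    nlinarith [sq_nonneg (s - t)]
  obtain ⟨b, hb⟩ := key
  refine ⟨b, ?_⟩
  rw [← Subtype.coe_le_coe, coe_absDiff_wave, one_div_mul_eq_div, le_div_iff₀ hp,
    Set.Icc.coe_mul, coe_halfPow]
  rw [hd] at hb
  linarith

/-! ### Sufficiency: reductions built from waves -/

section

variable {f g : I → ℝ≥0}

/-- The partial sums of `M` are the rounded-up running maxima of `f / g`; the hypothesis says that
passing to running maxima costs at most the factor `C`. -/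
theorem exists_increments_of_almost_increasing (hf : IsGauge f) (hg : IsGauge g) (C : ℝ≥0)
    (h : ∀ m n, m ≤ n → f (halfPow m) * g (halfPow n) ≤ C * (f (halfPow n) * g (halfPow m))) :
    ∃ (M : ℕ → ℕ) (A : ℝ≥0), ∀ n, f (halfPow n) ≤ (∑ i ∈ Finset.range (n + 1), M i : ℕ) *
      g (halfPow n) ∧ (∑ i ∈ Finset.range (n + 1), M i : ℕ) * g (halfPow n) ≤
        A * f (halfPow n) := by
  set r : ℕ → ℝ≥0 := fun n => f (halfPow n) / g (halfPow n) with hr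
  set R : ℕ → ℝ≥0 := fun n => (Finset.range (n + 1)).sup r with hR
  have hRm : Monotone R := fun m n hmn =>
    Finset.sup_mono (Finset.range_mono (Nat.succ_le_succ hmn))
  have hrR : ∀ n, r n ≤ R n := fun n => Finset.le_sup (f := r) (Finset.self_mem_range_succ n)
  have hRr : ∀ n, R n ≤ C * r n := fun n => Finset.sup_le fun m hm => by
    have := h m n (Nat.lt_succ_iff.1 (Finset.mem_range.1 hm))
    rw [hr, div_le_iff₀ (hg.halfPow_pos m), mul_assoc, div_mul_eq_mul_div, mul_div_assoc',
      le_div_iff₀ (hg.halfPow_pos n)]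
    exact this
  have hr0 : 0 < r 0 := div_pos (hf.halfPow_pos 0) (hg.halfPow_pos 0)
  have hR0 : ∀ n, r 0 ≤ R n := fun n => (hrR 0).trans (hRm n.zero_le)
  set N : ℕ → ℕ := fun n => ⌈R n⌉₊ with hN
  have hNm : Monotone N := fun m n hmn => Nat.ceil_mono (hRm hmn)
  set M : ℕ → ℕ := fun n => N n - (if n = 0 then 0 else N (n - 1)) with hM
  have hsum : ∀ n, ∑ i ∈ Finset.range (n + 1), M i = N n := by
    intro n
    induction n with
    | zero => simp [hM]
    | succ n ih =>
      rw [Finset.sum_range_succ, ih]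
      simp only [hM, Nat.add_eq_zero_iff, one_ne_zero, and_false, if_false, Nat.add_sub_cancel]
      have := hNm n.le_succ
      simp only [Nat.succ_eq_add_one] at this
      omega
  -- Rounding up adds at most `1`, and `1 ≤ (1 / r 0) * R n` because the running maximum never drops
  -- below `r 0`.
  refine ⟨M, (1 + 1 / r 0) * C, fun n => ?_⟩
  rw [hsum]
  have hgn := hg.halfPow_pos n
  constructor
  · rw [← div_le_iff₀ hgn]
    exact (hrR n).trans (Nat.le_ceil _)
  · have h1 : (N n : ℝ≥0) ≤ (1 + 1 / r 0) * R n := by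
      refine (Nat.ceil_lt_add_one zero_le).le.trans ?_
      rw [add_mul, one_mul]
      gcongr
      rw [one_div, ← div_eq_inv_mul, le_div_iff₀ hr0, one_mul]
      exact hR0 n
    calc (N n : ℝ≥0) * g (halfPow n) ≤ (1 + 1 / r 0) * (C * r n) * g (halfPow n) := by
          gcongr
          exact h1.trans (by gcongr; exact hRr n)
      _ = (1 + 1 / r 0) * C * (r n * g (halfPow n)) := by ring
      _ = _ := by rw [hr, div_mul_cancel₀ _ hgn.ne']

/-- The total weight of the waves at all scales `i`, taken `M i` times. -/
noncomputable def waveSum (g : I → ℝ≥0) (M : ℕ → ℕ) (x y : I) : ℝ≥0∞ :=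
  ∑' i, (M i : ℝ≥0∞) * ∑' b, (g (absDiff (wave i b x) (wave i b y)) : ℝ≥0∞)

/-- The countably many maps whose total weight is given by `waveSum`. -/
noncomputable def waveMap (M : ℕ → ℕ) (p : ℕ × ℕ × Bool) (x : I) : I :=
  if p.2.1 < M p.1 then wave p.1 p.2.2 x else 0

theorem measurable_waveMap (M : ℕ → ℕ) (p : ℕ × ℕ × Bool) : Measurable (waveMap M p) := by
  unfold waveMap
  split_ifs
  · exact (continuous_wave _ _).measurable
  · exact measurable_const

theorem tsum_waveMap (hg : IsGauge g) (M : ℕ → ℕ) (x y : I) :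
    ∑' p, (g (absDiff (waveMap M p x) (waveMap M p y)) : ℝ≥0∞) = waveSum g M x y := by
  rw [ENNReal.tsum_prod', waveSum]
  refine tsum_congr fun i => ?_
  rw [ENNReal.tsum_prod', tsum_eq_sum (s := Finset.range (M i))]
  · rw [Finset.sum_congr rfl (g := fun _ =>
      ∑' b, (g (absDiff (wave i b x) (wave i b y)) : ℝ≥0∞))]
    · simp [mul_add]
    · intro c hc
      simp only [waveMap, Finset.mem_range.1 hc, if_true]
  · intro c hc
    simp only [Finset.mem_range] at hc
    simp [waveMap, hc, absDiff_self, hg.map_zero]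

/-- Every coordinate is replaced by countably many, its images under `waveMap M p`, and the pairs of
indices are renumbered by `ℕ`; the two bounds make the two series converge together. -/
theorem borelReducible_of_waveSum (hg : IsGauge g) (M : ℕ → ℕ) (A B : ℝ≥0)
    (h1 : ∀ x y, (f (absDiff x y) : ℝ≥0∞) ≤ A * waveSum g M x y)
    (h2 : ∀ x y, waveSum g M x y ≤ B * f (absDiff x y)) :
    BorelReducible (ERel f) (ERel g) := by
  obtain ⟨e⟩ : Nonempty (ℕ ≃ ℕ × (ℕ × ℕ × Bool)) := nonempty_equiv_of_countable
  refine ⟨fun x n => waveMap M (e n).2 (x (e n).1), ?_, fun x y => ?_⟩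
  · exact measurable_pi_lambda _ fun n => (measurable_waveMap _ _).comp (measurable_pi_apply _)
  · have : ∑' n, (g (absDiff (waveMap M (e n).2 (x (e n).1)) (waveMap M (e n).2 (y (e n).1))) :
        ℝ≥0∞) = ∑' k, waveSum g M (x k) (y k) := by
      rw [e.tsum_eq (fun q => (g (absDiff (waveMap M q.2 (x q.1)) (waveMap M q.2 (y q.1))) :
        ℝ≥0∞)), ENNReal.tsum_prod']
      exact tsum_congr fun k => tsum_waveMap hg M (x k) (y k)
    rw [eRel_iff_tsum_ne_top, eRel_iff_tsum_ne_top, this]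
    constructor
    · intro h
      refine ne_top_of_le_ne_top (ENNReal.mul_ne_top (ENNReal.coe_ne_top (r := B)) h) ?_
      rw [← ENNReal.tsum_mul_left]
      exact ENNReal.tsum_le_tsum fun k => h2 _ _
    · intro h
      refine ne_top_of_le_ne_top (ENNReal.mul_ne_top (ENNReal.coe_ne_top (r := A)) h) ?_
      rw [← ENNReal.tsum_mul_left]
      exact ENNReal.tsum_le_tsum fun k => h1 _ _

theorem waveSum_self (hg : IsGauge g) (M : ℕ → ℕ) (x : I) : waveSum g M x x = 0 := by
  simp [waveSum, absDiff_self, hg.map_zero]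

theorem absDiff_ne_zero {x y : I} (h : x ≠ y) : absDiff x y ≠ 0 := by
  intro h0
  have := congrArg Subtype.val h0
  simp only [absDiff, Set.Icc.coe_zero, abs_eq_zero, sub_eq_zero] at this
  exact h (Subtype.ext this.symm)

theorem tsum_halfPow_le (hf : IsGauge f) (n : ℕ) :
    ∑' i, (f (halfPow (n + i)) : ℝ≥0∞) ≤ 2 * f (halfPow n) := by
  have h : ∀ i, (f (halfPow (n + i)) : ℝ≥0∞) ≤ f (halfPow n) * 2⁻¹ ^ i := by
    intro i
    induction i with
    | zero => simp
    | succ i ih =>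
      rw [pow_succ, ← mul_assoc]
      refine le_trans ?_ (mul_le_mul_left ih _)
      have := hf.halfPow_succ_le (n + i)
      rw [div_eq_mul_inv] at this
      have h2 : ((2⁻¹ : ℝ≥0) : ℝ≥0∞) = 2⁻¹ := by simp
      rw [← h2]
      exact_mod_cast this
  refine (ENNReal.tsum_le_tsum h).trans ?_
  rw [ENNReal.tsum_mul_left, ENNReal.tsum_geometric, ENNReal.one_sub_inv_two, inv_inv, mul_comm]

/-- Only the scales `i ≤ n`, with `2⁻ⁿ` just above the distance, are kept: there one of the two
waves preserves the distance up to the factor `1/8`. -/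
theorem exists_le_mul_waveSum (hf : IsGauge f) (hg : IsGauge g) (M : ℕ → ℕ)
    (hM : ∀ n, f (halfPow n) ≤ (∑ i ∈ Finset.range (n + 1), M i : ℕ) * g (halfPow n)) :
    ∃ A : ℝ≥0, ∀ x y, (f (absDiff x y) : ℝ≥0∞) ≤ A * waveSum g M x y := by
  obtain ⟨K, hK⟩ := hg.exists_le_mul_halfPow 1
  obtain ⟨L, hL⟩ := hg.exists_le_mul_halfPow 3
  refine ⟨K * L, fun x y => ?_⟩
  by_cases hxy : x = y
  · simp [hxy, absDiff_self, hf.map_zero]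
  obtain ⟨n, hn, hn'⟩ := exists_halfPow_near (absDiff_ne_zero hxy)
  set d := absDiff x y
  have h1 : f d ≤ K * L * ((∑ i ∈ Finset.range (n + 1), M i : ℕ) * g (halfPow 3 * d)) := by
    calc f d ≤ f (halfPow n) := hf.monotone hn'
      _ ≤ (∑ i ∈ Finset.range (n + 1), M i : ℕ) * g (halfPow n) := hM n
      _ ≤ (∑ i ∈ Finset.range (n + 1), M i : ℕ) * (K * (L * g (halfPow 3 * d))) := by
          gcongr
          refine (hK _).trans ?_
          gcongr
          rw [← halfPow_add, add_comm]
          exact (hg.monotone hn).trans (hL d)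
      _ = _ := by ring
  have h2 : (((∑ i ∈ Finset.range (n + 1), M i : ℕ) * g (halfPow 3 * d) : ℝ≥0) : ℝ≥0∞) ≤
      waveSum g M x y := by
    refine le_trans ?_ (ENNReal.sum_le_tsum (Finset.range (n + 1)))
    push_cast
    rw [Finset.sum_mul]
    refine Finset.sum_le_sum fun i hi => ?_
    obtain ⟨b, hb⟩ := exists_le_absDiff_wave (i := i) (x := x) (y := y)
      (hn'.trans (halfPow_antitone (Nat.lt_succ_iff.1 (Finset.mem_range.1 hi))))
    gcongr
    refine le_trans ?_ (ENNReal.le_tsum b)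
    exact_mod_cast hg.monotone hb
  calc (f d : ℝ≥0∞) ≤
        ((K * L * ((∑ i ∈ Finset.range (n + 1), M i : ℕ) * g (halfPow 3 * d)) : ℝ≥0) : ℝ≥0∞) := by
          exact_mod_cast h1
    _ ≤ _ := by
          rw [ENNReal.coe_mul]
          gcongr

theorem tsum_wave_le (hg : IsGauge g) {x y e : I} (i : ℕ)
    (h : ∀ b, absDiff (wave i b x) (wave i b y) ≤ e) :
    ∑' b, (g (absDiff (wave i b x) (wave i b y)) : ℝ≥0∞) ≤ 2 * g e := by
  rw [tsum_bool, two_mul]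
  exact add_le_add (ENNReal.coe_le_coe.2 (hg.monotone (h _)))
    (ENNReal.coe_le_coe.2 (hg.monotone (h _)))

theorem sum_wave_le (hg : IsGauge g) (M : ℕ → ℕ) {x y : I} {n : ℕ}
    (h : absDiff x y ≤ halfPow n) :
    ∑ i ∈ Finset.range (n + 1), (M i : ℝ≥0∞) *
      ∑' b, (g (absDiff (wave i b x) (wave i b y)) : ℝ≥0∞) ≤
      2 * ((∑ i ∈ Finset.range (n + 1), M i : ℕ) * g (halfPow n) : ℝ≥0) := by
  calc _ ≤ ∑ i ∈ Finset.range (n + 1), (M i : ℝ≥0∞) * (2 * g (halfPow n)) :=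
        Finset.sum_le_sum fun i _ => mul_le_mul' le_rfl
          (tsum_wave_le hg i fun b => (absDiff_wave_le_absDiff _ _ _ _).trans h)
    _ = _ := by
        rw [← Finset.sum_mul]
        push_cast
        ring

/-- At scales finer than the distance only the amplitude `2⁻ⁱ` bounds the waves. Their weight `M i *
g(2⁻ⁱ)` is at most `A * f(2⁻ⁱ)`, and `f` at least halves from one scale to the next. -/
theorem tsum_wave_tail_le (hf : IsGauge f) (hg : IsGauge g) (M : ℕ → ℕ) (A : ℝ≥0)
    (hM : ∀ n, (∑ i ∈ Finset.range (n + 1), M i : ℕ) * g (halfPow n) ≤ A * f (halfPow n))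
    (x y : I) (n : ℕ) :
    ∑' i, (M (i + (n + 1)) : ℝ≥0∞) *
      ∑' b, (g (absDiff (wave (i + (n + 1)) b x) (wave (i + (n + 1)) b y)) : ℝ≥0∞) ≤
      4 * (A * f (halfPow n) : ℝ≥0) := by
  have h3 : ∀ i, (M (i + (n + 1)) : ℝ≥0) * g (halfPow (i + (n + 1))) ≤
      A * f (halfPow (n + i)) := fun i => by
    refine le_trans (mul_le_mul' ?_ le_rfl) ((hM (i + (n + 1))).trans (mul_le_mul' le_rfl ?_))
    · exact_mod_cast Finset.single_le_sum (f := M) (fun _ _ => Nat.zero_le _)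
        (Finset.self_mem_range_succ _)
    · exact hf.monotone (halfPow_antitone (by omega))
  calc _ ≤ ∑' i, (2 * A : ℝ≥0∞) * f (halfPow (n + i)) := by
        refine ENNReal.tsum_le_tsum fun i => ?_
        calc _ ≤ (M (i + (n + 1)) : ℝ≥0∞) * (2 * g (halfPow (i + (n + 1)))) :=
              mul_le_mul' le_rfl (tsum_wave_le hg _ fun b => absDiff_wave_le_halfPow _ _ _ _)
          _ = 2 * ((M (i + (n + 1)) * g (halfPow (i + (n + 1))) : ℝ≥0) : ℝ≥0∞) := by
              push_cast
              ring
          _ ≤ 2 * ((A * f (halfPow (n + i)) : ℝ≥0) : ℝ≥0∞) :=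
              mul_le_mul' le_rfl (ENNReal.coe_le_coe.2 (h3 i))
          _ = _ := by
              push_cast
              ring
    _ ≤ (2 * A : ℝ≥0∞) * (2 * f (halfPow n)) := by
        rw [ENNReal.tsum_mul_left]
        exact mul_le_mul' le_rfl (tsum_halfPow_le hf n)
    _ = _ := by
        push_cast
        ring

theorem exists_waveSum_le_mul (hf : IsGauge f) (hg : IsGauge g) (M : ℕ → ℕ) (A : ℝ≥0)
    (hM : ∀ n, (∑ i ∈ Finset.range (n + 1), M i : ℕ) * g (halfPow n) ≤ A * f (halfPow n)) :
    ∃ B : ℝ≥0, ∀ x y, waveSum g M x y ≤ B * f (absDiff x y) := by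
  obtain ⟨K, hK⟩ := hf.exists_le_mul_halfPow 1
  -- `6 = 2 + 4`, from the coarse and the fine scales; `K` pays for moving from `2⁻ⁿ` to the actual
  -- distance.
  refine ⟨6 * A * K, fun x y => ?_⟩
  by_cases hxy : x = y
  · simp [hxy, waveSum_self hg]
  obtain ⟨n, hn, hn'⟩ := exists_halfPow_near (absDiff_ne_zero hxy)
  have hfn : f (halfPow n) ≤ K * f (absDiff x y) := by
    refine (hK _).trans ?_
    rw [← halfPow_add, add_comm]
    exact mul_le_mul' le_rfl (hf.monotone hn)
  have h1 := (sum_wave_le hg M hn').trans (mul_le_mul' le_rfl (ENNReal.coe_le_coe.2 (hM n)))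
  have h2 := add_le_add h1 (tsum_wave_tail_le hf hg M A hM x y n)
  rw [ENNReal.summable.sum_add_tsum_nat_add'] at h2
  calc waveSum g M x y ≤ 2 * ((A * f (halfPow n) : ℝ≥0) : ℝ≥0∞) +
        4 * ((A * f (halfPow n) : ℝ≥0) : ℝ≥0∞) := h2
    _ = ((6 * A * f (halfPow n) : ℝ≥0) : ℝ≥0∞) := by
        push_cast
        ring
    _ ≤ ((6 * A * K * f (absDiff x y) : ℝ≥0) : ℝ≥0∞) := by
        rw [ENNReal.coe_le_coe, mul_assoc _ K]
        exact mul_le_mul' le_rfl hfn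
    _ = _ := by push_cast; ring

theorem borelReducible_of_almost_increasing (hf : IsGauge f) (hg : IsGauge g) (C : ℝ≥0)
    (h : ∀ m n, m ≤ n → f (halfPow m) * g (halfPow n) ≤ C * (f (halfPow n) * g (halfPow m))) :
    BorelReducible (ERel f) (ERel g) := by
  obtain ⟨M, A, hM⟩ := exists_increments_of_almost_increasing hf hg C h
  obtain ⟨A', hA'⟩ := exists_le_mul_waveSum hf hg M fun n => (hM n).1
  obtain ⟨B, hB⟩ := exists_waveSum_le_mul hf hg M A fun n => (hM n).2
  exact borelReducible_of_waveSum hg M A' B hA' hB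

end

/-! ### Baire category: continuity on a dense Gδ set -/

/-- Countably many measurable sets become relatively open on a suitable dense `Gδ` set. -/
theorem exists_dense_iInter_forall_mem_nhdsWithin {X ι : Type*} [TopologicalSpace X] [BaireSpace X]
    [MeasurableSpace X] [BorelSpace X] [Countable ι] (P : ι → Set X)
    (hP : ∀ i, MeasurableSet (P i)) :
    ∃ D : ℕ → Set X, (∀ n, IsOpen (D n)) ∧ Dense (⋂ n, D n) ∧
      ∀ i, ∀ x ∈ ⋂ n, D n, x ∈ P i → P i ∈ 𝓝[⋂ n, D n] x := by
  -- Borel sets have the Baire property: each agrees with an open set off a meagre set.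
  choose U hU hPU using fun i => (hP i).residualEq_isOpen
  have h1 : {x | ∀ i, x ∈ P i ↔ x ∈ U i} ∈ residual X := by
    refine eventually_countable_forall.2 fun i => ?_
    filter_upwards [hPU i] with x hx
    exact iff_of_eq hx
  obtain ⟨t, hts, htG, htd⟩ := mem_residual.1 h1
  obtain ⟨D, hD, rfl⟩ := isGδ_iff_eq_iInter_nat.1 htG
  refine ⟨D, hD, htd, fun i x hx hxP => ?_⟩
  refine mem_nhdsWithin.2 ⟨U i, hU i, (hts hx i).1 hxP, fun y hy => ?_⟩
  exact (hts hy.2 i).2 hy.1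

/-- Adding the preimages of a countable basis to the family of sets turns relative openness into
continuity of `θ`. -/
theorem exists_dense_iInter_continuousOn {X Y ι : Type*} [TopologicalSpace X] [BaireSpace X]
    [MeasurableSpace X] [BorelSpace X] [TopologicalSpace Y] [SecondCountableTopology Y]
    [MeasurableSpace Y] [BorelSpace Y] [Countable ι] {θ : X → Y} (hθ : Measurable θ)
    (P : ι → Set X) (hP : ∀ i, MeasurableSet (P i)) :
    ∃ D : ℕ → Set X, (∀ n, IsOpen (D n)) ∧ Dense (⋂ n, D n) ∧ ContinuousOn θ (⋂ n, D n) ∧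
      ∀ i, ∀ x ∈ ⋂ n, D n, x ∈ P i → P i ∈ 𝓝[⋂ n, D n] x := by
  have hb := TopologicalSpace.isBasis_countableBasis Y
  have : Countable (TopologicalSpace.countableBasis Y) :=
    (TopologicalSpace.countable_countableBasis Y).to_subtype
  obtain ⟨D, hD, hd, h⟩ := exists_dense_iInter_forall_mem_nhdsWithin
    (Sum.elim P fun s : TopologicalSpace.countableBasis Y => θ ⁻¹' s) (by
      rintro (i | s)
      · exact hP i
      · exact hθ (hb.isOpen s.2).measurableSet)
  refine ⟨D, hD, hd, fun x hx => ?_, fun i => h (Sum.inl i)⟩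
  refine hb.nhds_hasBasis.tendsto_right_iff.2 fun s hs => ?_
  exact h (Sum.inr ⟨s, hs.1⟩) x hx hs.2

theorem exists_eqOn_Iio_imp_mem {O : Set (ℕ → ℕ)} (hO : IsOpen O) {x : ℕ → ℕ} (hx : x ∈ O) :
    ∃ m, ∀ y, Set.EqOn y x (Set.Iio m) → y ∈ O := by
  obtain ⟨_, ⟨z, m, rfl⟩, hxm, hm⟩ :=
    (PiNat.isTopologicalBasis_cylinders (E := fun _ => ℕ)).exists_subset_of_mem_open hx hO
  refine ⟨m, fun y hy => hm ?_⟩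
  rw [← PiNat.mem_cylinder_iff_eq.1 hxm, PiNat.mem_cylinder_iff]
  exact fun i hi => hy hi

/-- A family of open sets with dense union can be met simultaneously by all bounded prefixes
of length `b`, by prescribing finitely many further coordinates. -/
theorem exists_eqOn_Ico_imp_mem {𝒪 : Set (Set (ℕ → ℕ))} (hO : ∀ O ∈ 𝒪, IsOpen O)
    (hd : Dense (⋃₀ 𝒪)) {b b' : ℕ} (c : ℕ) (hb : b ≤ b') (w : ℕ → ℕ) :
    ∃ e ≥ b', ∃ w' : ℕ → ℕ, Set.EqOn w' w (Set.Iio b') ∧ ∀ r : Fin b → Fin (c + 1),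
      ∃ O ∈ 𝒪, ∀ y : ℕ → ℕ, (∀ i : Fin b, y i = r i) → Set.EqOn y w' (Set.Ico b e) → y ∈ O := by
  classical
  suffices h : ∀ S : Finset (Fin b → Fin (c + 1)),
      ∃ e ≥ b', ∃ w' : ℕ → ℕ, Set.EqOn w' w (Set.Iio b') ∧ ∀ r ∈ S,
      ∃ O ∈ 𝒪, ∀ y : ℕ → ℕ, (∀ i : Fin b, y i = r i) → Set.EqOn y w' (Set.Ico b e) → y ∈ O by
    obtain ⟨e, he, w', hw', h⟩ := h Finset.univ
    exact ⟨e, he, w', hw', fun r => h r (Finset.mem_univ r)⟩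
  intro S
  induction S using Finset.induction_on with
  | empty => exact ⟨b', le_rfl, w, fun _ _ => rfl, by simp⟩
  | insert r S _ ih =>
    obtain ⟨e, he, w', hw', h⟩ := ih
    -- The prefixes `r` are treated one at a time: density gives a point extending `r` and all the
    -- values fixed so far, and these only grow.
    let x : ℕ → ℕ := fun i => if h : i < b then r ⟨i, h⟩ else w' i
    have hVo : IsOpen {y : ℕ → ℕ | ∀ i < e, y i = x i} :=
      PiNat.isOpen_cylinder (E := fun _ => ℕ) x e
    obtain ⟨y, hyV, O, hOO, hyO⟩ := hd.inter_open_nonempty _ hVo ⟨x, fun _ _ => rfl⟩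
    obtain ⟨m, hm⟩ := exists_eqOn_Iio_imp_mem (hO O hOO) hyO
    refine ⟨max e m, he.trans (le_max_left _ _), fun i => if i < e then w' i else y i,
      fun i hi => ?_, fun s hs => ?_⟩
    · have : i < e := lt_of_lt_of_le hi he
      simp only [this, if_true]
      exact hw' hi
    · rcases Finset.mem_insert.1 hs with rfl | hs
      · refine ⟨O, hOO, fun v hv hvw => hm v fun i hi => ?_⟩
        by_cases hib : i < b
        · have h1 := hv ⟨i, hib⟩
          have h2 := hyV i (hib.trans_le (hb.trans he))
          simp only [x, hib, dif_pos] at h2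
          rw [h2]
          exact h1
        · have h1 := hvw ⟨not_lt.1 hib, lt_max_of_lt_right hi⟩
          by_cases hie : i < e
          · have h2 := hyV i hie
            simp only [x, hib, dif_neg, not_false_eq_true] at h2
            simp only [hie, if_true] at h1
            rw [h1, h2]
          · simpa only [hie, if_false] using h1
      · obtain ⟨O', hO', h'⟩ := h s hs
        refine ⟨O', hO', fun v hv hvw => h' v hv fun i hi => ?_⟩
        have h1 := hvw ⟨hi.1, lt_max_of_lt_left hi.2⟩
        simpa only [hi.2, if_true] using h1

/-! ### Fusion: making a Borel map modular -/

/-- Replace the first `b` entries of `y` by `r`. -/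
def glue (b : ℕ) (r : Fin b → ℕ) (y : ℕ → ℕ) (i : ℕ) : ℕ := if h : i < b then r ⟨i, h⟩ else y i

theorem measurable_glue (b : ℕ) (r : Fin b → ℕ) : Measurable (glue b r) := by
  refine measurable_pi_lambda _ fun i => ?_
  unfold glue
  split_ifs
  · exact measurable_const
  · exact measurable_pi_apply i

/-- The points `x` for which, among all changes of the first `b` coordinates bounded by `c`, the
images under `θ` have distance at most `2⁻ʲ`, as measured by `g` on the coordinates `≥ l`. -/
def tailSet (θ : (ℕ → ℕ) → ℕ → I) (g : I → ℝ≥0) (b c l j : ℕ) : Set (ℕ → ℕ) :=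
  {x | ∀ (r s : Fin b → Fin (c + 1)) (m : ℕ), ∑ n ∈ Finset.Ico l m,
    g (absDiff (θ (glue b (fun i => r i) x) n) (θ (glue b (fun i => s i) x) n)) ≤ (1 / 2) ^ j}

theorem measurableSet_tailSet {θ : (ℕ → ℕ) → ℕ → I} (hθ : Measurable θ) {g : I → ℝ≥0}
    (hg : IsGauge g) (b c l j : ℕ) : MeasurableSet (tailSet θ g b c l j) := by
  simp only [tailSet, Set.ofPred_forall]
  refine .iInter fun r => .iInter fun s => .iInter fun m => ?_
  refine measurableSet_le (Finset.measurable_fun_sum _ fun n _ => ?_) measurable_const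
  have h : ∀ r, Measurable fun x => θ (glue b r x) n := fun r =>
    (measurable_pi_apply n).comp (hθ.comp (measurable_glue b r))
  exact hg.measurable.comp (continuous_absDiff.measurable.comp ((h _).prodMk (h _)))

theorem NNReal.eventually_sum_Ico_le {a : ℕ → ℝ≥0} (ha : Summable a) {ε : ℝ≥0} (hε : 0 < ε) :
    ∀ᶠ l in atTop, ∀ m, ∑ n ∈ Finset.Ico l m, a n ≤ ε := by
  filter_upwards [(NNReal.tendsto_sum_nat_add a).eventually (Iic_mem_nhds hε)] with l hl m
  rw [Finset.sum_Ico_eq_sum_range]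
  refine le_trans ?_ hl
  simp only [add_comm l]
  exact ((NNReal.summable_nat_add_iff l).2 ha).sum_le_tsum _ fun _ _ => zero_le

/-- There are finitely many pairs of bounded prefixes, and each pair gives a finite change, hence a
convergent series whose tails become small. -/
theorem eventually_mem_tailSet {θ : (ℕ → ℕ) → ℕ → I} {g : I → ℝ≥0}
    (h : ∀ x y : ℕ → ℕ, (∀ᶠ n in atTop, x n = y n) → ERel g (θ x) (θ y)) (b c j : ℕ)
    (x : ℕ → ℕ) : ∀ᶠ l in atTop, x ∈ tailSet θ g b c l j := by
  refine eventually_all.2 fun r => eventually_all.2 fun s => ?_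
  refine NNReal.eventually_sum_Ico_le (h _ _ ?_) (by positivity)
  filter_upwards [eventually_ge_atTop b] with n hn
  simp [glue, not_lt.2 hn]

theorem IsGauge.tendsto_zero {g : I → ℝ≥0} (hg : IsGauge g) : Tendsto g (𝓝 0) (𝓝 0) := by
  rw [← NNReal.tendsto_coe]
  have h1 : Tendsto (fun t : I => (t : ℝ) * g 1) (𝓝 0) (𝓝 (((0 : I) : ℝ) * g 1)) :=
    (continuous_subtype_val.tendsto 0).mul_const _
  rw [Set.Icc.coe_zero, zero_mul] at h1
  refine squeeze_zero (fun t => (g t).2) (fun t => ?_) h1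
  simpa using hg.star t 1

theorem IsGauge.eventually_sum_range_le {g : I → ℝ≥0} (hg : IsGauge g) {θ : (ℕ → ℕ) → ℕ → I}
    {C : Set (ℕ → ℕ)} (hθ : ContinuousOn θ C) {x : ℕ → ℕ} (hx : x ∈ C) (l : ℕ) {ε : ℝ≥0}
    (hε : 0 < ε) : ∃ O, IsOpen O ∧ x ∈ O ∧ ∀ y ∈ O ∩ C, ∀ y' ∈ O ∩ C,
      ∑ n ∈ Finset.range l, g (absDiff (θ y n) (θ y' n)) ≤ ε := by
  have h1 : Tendsto (fun p : (ℕ → ℕ) × (ℕ → ℕ) =>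
      ∑ n ∈ Finset.range l, g (absDiff (θ p.1 n) (θ p.2 n))) (𝓝[C] x ×ˢ 𝓝[C] x) (𝓝 0) := by
    rw [← Finset.sum_const_zero (s := Finset.range l)]
    refine tendsto_finsetSum _ fun n _ => hg.tendsto_zero.comp ?_
    have h2 : Tendsto (fun y => θ y n) (𝓝[C] x) (𝓝 (θ x n)) :=
      ((continuous_apply n).tendsto _).comp (hθ x hx)
    have h3 := (continuous_absDiff.tendsto (θ x n, θ x n)).comp
      (((h2.comp tendsto_fst).prodMk_nhds (h2.comp tendsto_snd)))
    rw [absDiff_self] at h3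
    exact h3
  have h2 := h1.eventually (Iic_mem_nhds hε)
  obtain ⟨t, ht, h3⟩ := (eventually_prod_self_iff (r := fun y y' =>
    ∑ n ∈ Finset.range l, g (absDiff (θ y n) (θ y' n)) ≤ ε)).1 h2
  obtain ⟨O, hO, hxO, hOt⟩ := mem_nhdsWithin.1 ht
  exact ⟨O, hO, hxO, fun y hy y' hy' => h3 y (hOt hy) y' (hOt hy')⟩

/-- One stage of the fusion. Fixing the coordinates in `[b, e)` forces membership in the first dense
open sets, makes changes below `b` nearly invisible past `l`, and makes changes from `e` on nearly
invisible before `l`. -/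
theorem exists_stage {θ : (ℕ → ℕ) → ℕ → I} {g : I → ℝ≥0} (hg : IsGauge g)
    {D : ℕ → Set (ℕ → ℕ)} (hD : ∀ n, IsOpen (D n)) (hd : Dense (⋂ n, D n))
    (hθ : ContinuousOn θ (⋂ n, D n))
    (h : ∀ x y : ℕ → ℕ, (∀ᶠ n in atTop, x n = y n) → ERel g (θ x) (θ y))
    (hB : ∀ b c l j, ∀ x ∈ ⋂ n, D n, x ∈ tailSet θ g b c l j →
      tailSet θ g b c l j ∈ 𝓝[⋂ n, D n] x)
    (j b c L : ℕ) (w : ℕ → ℕ) :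
    ∃ e ≥ b, ∃ w' : ℕ → ℕ, ∃ l ≥ L, Set.EqOn w' w (Set.Iio b) ∧
      (∀ y : ℕ → ℕ, (∀ i < b, y i ≤ c) → Set.EqOn y w' (Set.Ico b e) → ∀ k ≤ j, y ∈ D k) ∧
      (∀ y ∈ ⋂ n, D n, (∀ i < b, y i = 0) → Set.EqOn y w' (Set.Ico b e) →
        y ∈ tailSet θ g b c l j) ∧
      (∀ y ∈ ⋂ n, D n, ∀ y' ∈ ⋂ n, D n, (∀ i < b, y i ≤ c) → Set.EqOn y w' (Set.Ico b e) →
        Set.EqOn y' y (Set.Iio e) →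
        ∑ n ∈ Finset.range l, g (absDiff (θ y n) (θ y' n)) ≤ (1 / 2) ^ j) := by
  obtain ⟨e₁, he₁, w₁, hw₁, h₁⟩ := exists_eqOn_Ico_imp_mem
    (𝒪 := {O | IsOpen O ∧ ∃ l ≥ L, O ∩ (⋂ n, D n) ⊆ tailSet θ g b c l j}) (fun O hO => hO.1)
    (hd.mono fun x hx => by
      obtain ⟨l, hl, hl'⟩ := ((eventually_mem_tailSet h b c j x).and (eventually_ge_atTop L)).exists
      obtain ⟨O, hO, hxO, hO'⟩ := mem_nhdsWithin.1 (hB b c l j x hx hl)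
      exact ⟨O, ⟨hO, l, hl', hO'⟩, hxO⟩) c (le_refl b) w
  -- The zero prefix suffices, since `tailSet` already quantifies over all bounded prefixes. The
  -- bound `l` must be chosen before continuity is invoked on the coordinates below `l`.
  obtain ⟨O, ⟨-, l, hl, hOl⟩, hO⟩ := h₁ fun _ => 0
  obtain ⟨e, he, w', hw', h₂⟩ := exists_eqOn_Ico_imp_mem
    (𝒪 := {O | IsOpen O ∧ (∀ k ≤ j, O ⊆ D k) ∧ ∀ y ∈ O ∩ (⋂ n, D n), ∀ y' ∈ O ∩ (⋂ n, D n),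
      ∑ n ∈ Finset.range l, g (absDiff (θ y n) (θ y' n)) ≤ (1 / 2) ^ j}) (fun O hO => hO.1)
    (hd.mono fun x hx => by
      obtain ⟨O, hO, hxO, hO'⟩ := hg.eventually_sum_range_le hθ hx l (ε := (1 / 2) ^ j)
        (by positivity)
      refine ⟨O ∩ ⋂ k ∈ Set.Iic j, D k, ⟨hO.inter ((Set.finite_Iic j).isOpen_biInter
        fun k _ => hD k), fun k hk y hy => ?_, fun y hy y' hy' =>
          hO' y ⟨hy.1.1, hy.2⟩ y' ⟨hy'.1.1, hy'.2⟩⟩, hxO, ?_⟩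
      · exact Set.mem_iInter₂.1 hy.2 k hk
      · exact Set.mem_iInter₂.2 fun k _ => Set.mem_iInter.1 hx k) c he₁ w₁
  refine ⟨e, he₁.trans he, w', l, hl, fun i hi => ?_, fun y hy hyw k hk => ?_,
    fun y hyD hy hyw => ?_, fun y hyD y' hyD' hy hyw hyy' => ?_⟩
  · exact (hw' (lt_of_lt_of_le hi he₁)).trans (hw₁ hi)
  · obtain ⟨O', hO', hO''⟩ := h₂ fun i => ⟨y i, Nat.lt_succ_of_le (hy i i.2)⟩
    exact hO'.2.1 k hk (hO'' y (fun i => rfl) hyw)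
  · refine hOl ⟨hO y (fun i => by simpa using hy i i.2) fun i hi => ?_, hyD⟩
    exact (hyw ⟨hi.1, hi.2.trans_le he⟩).trans (hw' hi.2)
  · obtain ⟨O', hO', hO''⟩ := h₂ fun i => ⟨y i, Nat.lt_succ_of_le (hy i i.2)⟩
    refine hO'.2.2 y ⟨hO'' y (fun i => rfl) hyw, hyD⟩ y' ⟨hO'' y' (fun i => ?_) fun i hi => ?_, hyD'⟩
    · exact hyy' (i.2.trans_le (he₁.trans he))
    · exact (hyy' hi.2).trans (hyw hi)

/-- Stages are iterated, each leaving the single position `e j` free before the next begins at `e j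
+ 1`. The bounds `c j` grow to dominate `ζ j` and all values already fixed. -/
theorem exists_fusion {θ : (ℕ → ℕ) → ℕ → I} {g : I → ℝ≥0} (hg : IsGauge g)
    {D : ℕ → Set (ℕ → ℕ)} (hD : ∀ n, IsOpen (D n)) (hd : Dense (⋂ n, D n))
    (hθ : ContinuousOn θ (⋂ n, D n))
    (h : ∀ x y : ℕ → ℕ, (∀ᶠ n in atTop, x n = y n) → ERel g (θ x) (θ y))
    (hB : ∀ b c l j, ∀ x ∈ ⋂ n, D n, x ∈ tailSet θ g b c l j →
      tailSet θ g b c l j ∈ 𝓝[⋂ n, D n] x) (ζ : ℕ → ℕ) :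
    ∃ (b c e l w : ℕ → ℕ), b 0 = 1 ∧ l 0 = 0 ∧ StrictMono l ∧ Monotone c ∧ (∀ j, ζ j ≤ c j) ∧
      (∀ j, b j ≤ e j) ∧ (∀ j, b (j + 1) = e j + 1) ∧ (∀ j, ∀ i < b j, w i ≤ c j) ∧
      (∀ j, ∀ y : ℕ → ℕ, (∀ i < b j, y i ≤ c j) → Set.EqOn y w (Set.Ico (b j) (e j)) →
        ∀ k ≤ j, y ∈ D k) ∧
      (∀ j, ∀ y ∈ ⋂ n, D n, (∀ i < b j, y i = 0) → Set.EqOn y w (Set.Ico (b j) (e j)) →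
        y ∈ tailSet θ g (b j) (c j) (l (j + 1)) j) ∧
      (∀ j, ∀ y ∈ ⋂ n, D n, ∀ y' ∈ ⋂ n, D n, (∀ i < b j, y i ≤ c j) →
        Set.EqOn y w (Set.Ico (b j) (e j)) → Set.EqOn y' y (Set.Iio (e j)) →
        ∑ n ∈ Finset.range (l (j + 1)), g (absDiff (θ y n) (θ y' n)) ≤ (1 / 2) ^ j) := by
  choose e he w' l hl hw hα hβ hγ using exists_stage hg hD hd hθ h hB
  -- The state records the prefix length `b`, the bound `c` on its entries, the output position `l`,
  -- and the current sequence of fixed values.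
  let S : ℕ → ℕ × ℕ × ℕ × (ℕ → ℕ) := fun j => Nat.rec (1, ζ 0, 0, fun _ => 0)
    (fun j s => (e j s.1 s.2.1 (s.2.2.1 + 1) s.2.2.2 + 1,
      s.2.1 + ζ (j + 1) + ∑ i ∈ Finset.range (e j s.1 s.2.1 (s.2.2.1 + 1) s.2.2.2 + 1),
        w' j s.1 s.2.1 (s.2.2.1 + 1) s.2.2.2 i,
      l j s.1 s.2.1 (s.2.2.1 + 1) s.2.2.2, w' j s.1 s.2.1 (s.2.2.1 + 1) s.2.2.2)) j
  let b : ℕ → ℕ := fun j => (S j).1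
  let c : ℕ → ℕ := fun j => (S j).2.1
  let L : ℕ → ℕ := fun j => (S j).2.2.1
  let W : ℕ → ℕ → ℕ := fun j => (S j).2.2.2
  let E : ℕ → ℕ := fun j => e j (b j) (c j) (L j + 1) (W j)
  have hb : ∀ j, b (j + 1) = E j + 1 := fun j => rfl
  have hbE : ∀ j, b j ≤ E j := fun j => he _ _ _ _ _
  have hc : ∀ j, c (j + 1) = c j + ζ (j + 1) + ∑ i ∈ Finset.range (b (j + 1)), W (j + 1) i :=
    fun j => rfl
  have hW : ∀ j, Set.EqOn (W (j + 1)) (W j) (Set.Iio (b j)) := fun j => hw _ _ _ _ _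
  have hbm : Monotone b := monotone_nat_of_le_succ fun j => by
    rw [hb]; exact (hbE j).trans (Nat.le_succ _)
  have hbj : ∀ j, j < b j := by
    intro j
    induction j with
    | zero => exact Nat.one_pos
    | succ j ih => rw [hb]; exact Nat.succ_lt_succ (lt_of_lt_of_le ih (hbE j))
  have hWk : ∀ j k, Set.EqOn (W (j + k)) (W j) (Set.Iio (b j)) := by
    intro j k
    induction k with
    | zero => exact fun _ _ => rfl
    | succ k ih =>
      intro i hi
      exact (hW (j + k) (lt_of_lt_of_le hi (hbm (Nat.le_add_right j k)))).trans (ih hi)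
  -- Since `i < b i`, the `i`-th entry no longer changes after stage `i`, so the diagonal is the
  -- limit of the approximations.
  have hwW : ∀ j, Set.EqOn (fun i => W i i) (W j) (Set.Iio (b j)) := by
    intro j i hi
    rcases le_total i j with hij | hij
    · obtain ⟨k, rfl⟩ := Nat.exists_eq_add_of_le hij
      exact (hWk i k (hbj i)).symm
    · obtain ⟨k, rfl⟩ := Nat.exists_eq_add_of_le hij
      exact hWk j k hi
  have hwW' : ∀ {j} {y : ℕ → ℕ}, Set.EqOn y (fun i => W i i) (Set.Ico (b j) (E j)) →
      Set.EqOn y (W (j + 1)) (Set.Ico (b j) (E j)) := fun {j y} hy i hi =>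
    (hy hi).trans (hwW (j + 1) (hi.2.trans (by rw [hb]; exact Nat.lt_succ_self _)))
  refine ⟨b, c, E, L, fun i => W i i, rfl, rfl, strictMono_nat_of_lt_succ fun j => hl _ _ _ _ _,
    monotone_nat_of_le_succ fun j => ?_, fun j => ?_, hbE, hb, fun j i hi => ?_,
    fun j y hy hyw => hα _ _ _ _ _ y hy (hwW' hyw),
    fun j y hyD hy hyw => hβ _ _ _ _ _ y hyD hy (hwW' hyw),
    fun j y hyD y' hyD' hy hyw => hγ _ _ _ _ _ y hyD y' hyD' hy (hwW' hyw)⟩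
  · rw [hc, add_assoc]
    exact Nat.le_add_right _ _
  · cases j with
    | zero => exact le_rfl
    | succ j => rw [hc]; omega
  · rw [hwW j hi]
    cases j with
    | zero => exact Nat.zero_le _
    | succ j =>
      rw [hc]
      exact (Finset.single_le_sum (f := W (j + 1)) (fun _ _ => Nat.zero_le _)
        (Finset.mem_range.2 hi)).trans (Nat.le_add_left _ _)

/-- After fixing some coordinates and restricting the others to finite sets, a Borel map that
respects finite changes becomes modular up to an `E_g`-negligible error. -/
theorem exists_modular {θ : (ℕ → ℕ) → ℕ → I} (hθ : Measurable θ) {g : I → ℝ≥0} (hg : IsGauge g)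
    (h : ∀ x y : ℕ → ℕ, (∀ᶠ n in atTop, x n = y n) → ERel g (θ x) (θ y)) (ζ : ℕ → ℕ) :
    ∃ N : ℕ → ℕ, N.Injective ∧ ∃ (w l : ℕ → ℕ) (K : ℝ≥0), l 0 = 0 ∧ StrictMono l ∧
      ∀ z z' : ℕ → ℕ, z ≤ ζ → z' ≤ ζ → ∀ j, z j = z' j →
        ∑ n ∈ Finset.Ico (l j) (l (j + 1)),
          g (absDiff (θ (N.extend z w) n) (θ (N.extend z' w) n)) ≤ K * (1 / 2) ^ j := by
  obtain ⟨D, hD, hd, hcont, hB⟩ := exists_dense_iInter_continuousOn hθ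
    (fun p : ℕ × ℕ × ℕ × ℕ => tailSet θ g p.1 p.2.1 p.2.2.1 p.2.2.2)
    (fun p => measurableSet_tailSet hθ hg _ _ _ _)
  obtain ⟨b, c, e, l, w, hb0, hl0, hl, hc, hζ, hbe, hb, hw, hα, hβ, hγ⟩ :=
    exists_fusion hg hD hd hcont h (fun b c l j => hB (b, c, l, j)) ζ
  obtain ⟨K, hK⟩ := hg.exists_quasi_triangle
  have hbm : StrictMono b := strictMono_nat_of_lt_succ fun j => by
    rw [hb]; exact Nat.lt_succ_of_le (hbe j)
  have hb1 : ∀ j, 1 ≤ b j := fun j => hb0 ▸ hbm.monotone j.zero_le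
  -- The free coordinates: `0`, and then `e j` for each stage `j`, as `b (j + 1) = e j + 1`.
  let N : ℕ → ℕ := fun j => b j - 1
  have hN : N.Injective := fun i j hij => hbm.injective (by
    have := hb1 i; have := hb1 j; simp only [N] at hij; omega)
  have hNb : ∀ {k j}, N k < b j → k ≤ j := by
    intro k j hkj
    by_contra! hlt
    have := hbm hlt
    have := hb1 k
    simp only [N] at hkj
    omega
  have hC : ∀ y j, (∀ k ≥ j, ∀ i < b k, y i ≤ c k) →
      (∀ k ≥ j, Set.EqOn y w (Set.Ico (b k) (e k))) → y ∈ ⋂ n, D n := fun y j h1 h2 =>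
    Set.mem_iInter.2 fun n => hα (max n j) y (h1 _ (le_max_right _ _)) (h2 _ (le_max_right _ _))
      n (le_max_left _ _)
  have hle : ∀ z ≤ ζ, ∀ k, ∀ i < b k, N.extend z w i ≤ c k := by
    intro z hz k i hi
    by_cases hex : ∃ j, N j = i
    · obtain ⟨j, rfl⟩ := hex
      rw [hN.extend_apply]
      exact (hz j).trans ((hζ j).trans (hc (hNb hi)))
    · rw [Function.extend_apply' _ _ _ hex]
      exact hw k i hi
  have heq : ∀ z k, Set.EqOn (N.extend z w) w (Set.Ico (b k) (e k)) := by
    intro z k i hi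
    refine Function.extend_apply' _ _ _ ?_
    rintro ⟨j, rfl⟩
    have h1 : N j < b (k + 1) := by rw [hb]; exact hi.2.trans (Nat.lt_succ_self _)
    have h2 := hNb h1
    rcases h2.lt_or_eq with h3 | rfl
    · have := hbm.monotone (Nat.lt_succ_iff.1 h3)
      have h4 : b k ≤ b j - 1 := hi.1
      have := hb1 j
      omega
    · have := hi.2
      simp only [N, hb, Nat.add_sub_cancel] at this
      exact lt_irrefl _ this
  have hext : ∀ z z' : ℕ → ℕ, ∀ i, (∀ j, N j = i → z j = z' j) →
      N.extend z w i = N.extend z' w i := by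
    intro z z' i hi
    by_cases hex : ∃ j, N j = i
    · obtain ⟨j, rfl⟩ := hex
      rw [hN.extend_apply, hN.extend_apply, hi j rfl]
    · rw [Function.extend_apply' _ _ _ hex, Function.extend_apply' _ _ _ hex]
  have hmem : ∀ z ≤ ζ, N.extend z w ∈ ⋂ n, D n := fun z hz =>
    hC _ 0 (fun k _ => hle z hz k) (fun k _ => heq z k)
  have hhead : ∀ z z' : ℕ → ℕ, z ≤ ζ → z' ≤ ζ → ∀ j, (∀ i ≤ j, z i = z' i) →
      ∑ n ∈ Finset.range (l (j + 1)),
        g (absDiff (θ (N.extend z w) n) (θ (N.extend z' w) n)) ≤ (1 / 2) ^ j := by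
    intro z z' hz hz' j hj
    refine hγ j _ (hmem z hz) _ (hmem z' hz') (hle z hz j) (heq z j) fun i hi => ?_
    refine hext _ _ _ fun k hk => (hj k ?_).symm
    subst hk
    have h1 : N k < e j := hi
    have h2 : k ≤ j + 1 := hNb (by rw [hb]; omega)
    rcases h2.lt_or_eq with h3 | rfl
    · omega
    · simp only [N, hb] at h1
      omega
  have htail : ∀ z z' : ℕ → ℕ, z ≤ ζ → z' ≤ ζ → ∀ j, (∀ i, j < i → z i = z' i) → ∀ m,
      ∑ n ∈ Finset.Ico (l (j + 1)) m,
        g (absDiff (θ (N.extend z w) n) (θ (N.extend z' w) n)) ≤ (1 / 2) ^ j := by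
    intro z z' hz hz' j hj m
    -- Both points arise from `y` by gluing in a bounded prefix of length `b j`, so a single
    -- membership of `y` in a tail set compares them.
    let y : ℕ → ℕ := fun i => if i < b j then 0 else N.extend z w i
    have hy0 : ∀ i < b j, y i = 0 := fun i hi => by simp only [y, hi, if_true]
    have hy1 : ∀ i, b j ≤ i → y i = N.extend z w i := fun i hi => by
      simp only [y, not_lt.2 hi, if_false]
    have hyD : y ∈ ⋂ n, D n := by
      refine hC y j (fun k hk i hi => ?_) fun k hk i hi => ?_
      · rcases lt_or_ge i (b j) with hij | hij
        · rw [hy0 i hij]; exact Nat.zero_le _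
        · rw [hy1 i hij]; exact hle z hz k i hi
      · rw [hy1 i ((hbm.monotone hk).trans hi.1)]; exact heq z k hi
    have key := hβ j y hyD hy0 fun i hi => (hy1 i hi.1).trans (heq z j hi)
    have hglue : ∀ z'' : ℕ → ℕ, z'' ≤ ζ → (∀ i, j < i → z i = z'' i) →
        ∃ r : Fin (b j) → Fin (c j + 1), glue (b j) (fun i => r i) y = N.extend z'' w := by
      intro z'' hz'' hj''
      refine ⟨fun i => ⟨N.extend z'' w i, Nat.lt_succ_of_le (hle z'' hz'' j i i.2)⟩, ?_⟩
      ext i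
      by_cases hi : i < b j
      · simp [glue, hi]
      · simp only [glue, hi, dif_neg, not_false_eq_true]
        rw [hy1 i (not_lt.1 hi)]
        refine hext _ _ _ fun k hk => hj'' k ?_
        subst hk
        by_contra! hkj
        have := hbm.monotone hkj
        have := hb1 k
        simp only [N] at hi
        omega
    obtain ⟨r, hr⟩ := hglue z hz fun _ _ => rfl
    obtain ⟨s, hs⟩ := hglue z' hz' hj
    have := key r s m
    rwa [hr, hs] at this
  refine ⟨N, hN, w, l, K * 3, hl0, hl, fun z z' hz hz' j hj => ?_⟩
  -- The hybrid sequence: it differs from `z` only after `j`, which the head estimate controls, and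
  -- from `z'` only before `j`, which the tail estimate of stage `j - 1` controls. For `j = 0` it
  -- equals `z'`.
  let z₁ : ℕ → ℕ := fun i => if i ≤ j then z i else z' i
  have hz₁ : z₁ ≤ ζ := fun i => by
    simp only [z₁]
    split_ifs
    exacts [hz i, hz' i]
  have h1 : ∑ n ∈ Finset.Ico (l j) (l (j + 1)),
      g (absDiff (θ (N.extend z w) n) (θ (N.extend z₁ w) n)) ≤ (1 / 2) ^ j := by
    refine le_trans (Finset.sum_le_sum_of_subset ?_) (hhead z z₁ hz hz₁ j fun i hi => ?_)
    · intro n hn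
      exact Finset.mem_range.2 (Finset.mem_Ico.1 hn).2
    · simp only [z₁, hi, if_true]
  have h2 : ∑ n ∈ Finset.Ico (l j) (l (j + 1)),
      g (absDiff (θ (N.extend z₁ w) n) (θ (N.extend z' w) n)) ≤ 2 * (1 / 2) ^ j := by
    cases j with
    | zero =>
      have : z₁ = z' := by
        ext i
        simp only [z₁]
        split_ifs with hi
        · rw [Nat.le_zero.1 hi, hj]
        · rfl
      simp [this, absDiff_self, hg.map_zero]
    | succ j =>
      refine (htail z₁ z' hz₁ hz' j (fun i hi => ?_) _).trans (le_of_eq ?_)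
      · simp only [z₁]
        split_ifs with hi'
        · rw [show i = j + 1 by omega, hj]
        · rfl
      · rw [pow_succ]
        field_simp
  calc _ ≤ ∑ n ∈ Finset.Ico (l j) (l (j + 1)), K *
        (g (absDiff (θ (N.extend z w) n) (θ (N.extend z₁ w) n)) +
          g (absDiff (θ (N.extend z₁ w) n) (θ (N.extend z' w) n))) :=
        Finset.sum_le_sum fun n _ => hK _ _ _
    _ ≤ K * ((1 / 2) ^ j + 2 * (1 / 2) ^ j) := by
        rw [← Finset.mul_sum, Finset.sum_add_distrib]
        gcongr
    _ = _ := by ring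

theorem NNReal.summable_sum_Ico_iff {a : ℕ → ℝ≥0} {l : ℕ → ℕ} (h0 : l 0 = 0)
    (hl : StrictMono l) :
    (Summable fun k => ∑ n ∈ Finset.Ico (l k) (l (k + 1)), a n) ↔ Summable a := by
  have hsum : ∀ k, ∑ j ∈ Finset.range k, ∑ n ∈ Finset.Ico (l j) (l (j + 1)), a n =
      ∑ n ∈ Finset.range (l k), a n := by
    intro k
    induction k with
    | zero => simp [h0]
    | succ k ih =>
      rw [Finset.sum_range_succ, ih, Finset.sum_range_add_sum_Ico _ (hl.monotone k.le_succ)]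
  constructor <;> intro h
  · refine NNReal.summable_of_sum_range_le
      (c := ∑' k, ∑ n ∈ Finset.Ico (l k) (l (k + 1)), a n) fun n => ?_
    · calc ∑ i ∈ Finset.range n, a i ≤ ∑ i ∈ Finset.range (l n), a i :=
            Finset.sum_le_sum_of_subset (Finset.range_mono (hl.id_le n))
        _ ≤ _ := by
            rw [← hsum]
            exact h.sum_le_tsum _ fun _ _ => zero_le
  · refine NNReal.summable_of_sum_range_le (c := ∑' n, a n) fun k => ?_
    · rw [hsum]
      exact h.sum_le_tsum _ fun _ _ => zero_le

/-! ### Necessity: paths of dyadic steps -/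

section

variable {f g : I → ℝ≥0}

/-- The distance of `u` and `v` on the finitely many coordinates in `s`. -/
noncomputable def partSum (g : I → ℝ≥0) (s : Finset ℕ) (u v : ℕ → I) : ℝ≥0 :=
  ∑ n ∈ s, g (absDiff (u n) (v n))

theorem partSum_comm (s : Finset ℕ) (u v : ℕ → I) : partSum g s u v = partSum g s v u := by
  simp only [partSum, absDiff_comm]

theorem IsGauge.partSum_self (hg : IsGauge g) (s : Finset ℕ) (u : ℕ → I) :
    partSum g s u u = 0 := by
  simp [partSum, absDiff_self, hg.map_zero]

theorem IsGauge.exists_partSum_le (hg : IsGauge g) : ∃ K : ℝ≥0, ∀ (s : Finset ℕ) (u v w : ℕ → I),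
    partSum g s u w ≤ K * (partSum g s u v + partSum g s v w) := by
  obtain ⟨K, hK⟩ := hg.exists_quasi_triangle
  refine ⟨K, fun s u v w => ?_⟩
  rw [partSum, partSum, partSum, ← Finset.sum_add_distrib, Finset.mul_sum]
  exact Finset.sum_le_sum fun n _ => hK _ _ _

/-- Take scales with `2ʲ f < g` and repeat the `j`-th about `1 / g` times: it then contributes at
least `1` to the `g`-sum and `O(2⁻ʲ)` to the `f`-sum. -/
theorem exists_summable_not_summable (hg : IsGauge g)
    (h : ∀ C : ℝ≥0, ∃ n, C * f (halfPow n) < g (halfPow n)) :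
    ∃ μ : ℕ → ℕ, (Summable fun k => f (halfPow (μ k))) ∧
      ¬ Summable fun k => g (halfPow (μ k)) := by
  choose ν hν using fun j : ℕ => h (2 ^ j)
  let R : ℕ → ℕ := fun j => ⌈1 / g (halfPow (ν j))⌉₊
  have hgν : ∀ j, 0 < g (halfPow (ν j)) := fun j => hg.halfPow_pos _
  have hR : ∀ j, 0 < R j := fun j => Nat.ceil_pos.2 (one_div_pos.2 (hgν j))
  have : Infinite (Σ j, Fin (R j)) :=
    Infinite.of_injective (fun j => (⟨j, ⟨0, hR j⟩⟩ : Σ j, Fin (R j))) fun i j hij => by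
      simpa using congrArg Sigma.fst hij
  obtain ⟨e⟩ : Nonempty (ℕ ≃ Σ j, Fin (R j)) := nonempty_equiv_of_countable
  have hsum : ∀ q : I → ℝ≥0, ∑' k, (q (halfPow (ν (e k).1)) : ℝ≥0∞) =
      ∑' j, (R j : ℝ≥0∞) * q (halfPow (ν j)) := by
    intro q
    rw [e.tsum_eq (fun t => (q (halfPow (ν t.1)) : ℝ≥0∞)), ENNReal.tsum_sigma']
    refine tsum_congr fun j => ?_
    rw [tsum_fintype]
    simp
  refine ⟨fun k => ν (e k).1, ?_, ?_⟩
  · rw [← ENNReal.tsum_coe_ne_top_iff_summable, hsum]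
    have h1 : ∀ j, (R j : ℝ≥0) * f (halfPow (ν j)) ≤ (1 + g 1) * (1 / 2) ^ j := by
      intro j
      have h2 : (R j : ℝ≥0) * g (halfPow (ν j)) ≤ 1 + g 1 := by
        calc (R j : ℝ≥0) * g (halfPow (ν j)) ≤
              (1 / g (halfPow (ν j)) + 1) * g (halfPow (ν j)) :=
              mul_le_mul' (Nat.ceil_lt_add_one zero_le).le le_rfl
          _ = 1 + g (halfPow (ν j)) := by
              rw [add_mul, one_mul, one_div_mul_cancel (hgν j).ne']
          _ ≤ _ := add_le_add le_rfl (hg.monotone (halfPow (ν j)).2.2)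
      have h3 : f (halfPow (ν j)) ≤ g (halfPow (ν j)) * (1 / 2) ^ j := by
        rw [div_pow, one_pow, mul_one_div, le_div_iff₀ (by positivity), mul_comm]
        exact (hν j).le
      calc (R j : ℝ≥0) * f (halfPow (ν j)) ≤ R j * (g (halfPow (ν j)) * (1 / 2) ^ j) :=
            mul_le_mul' le_rfl h3
        _ = R j * g (halfPow (ν j)) * (1 / 2) ^ j := by ring
        _ ≤ _ := mul_le_mul' h2 le_rfl
    have h4 : Summable fun j => (R j : ℝ≥0) * f (halfPow (ν j)) :=
      NNReal.summable_of_le h1 ((NNReal.summable_geometric (by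
        rw [← NNReal.coe_lt_coe]; norm_num)).mul_left _)
    simpa using ENNReal.tsum_coe_ne_top_iff_summable.2 h4
  · rw [← ENNReal.tsum_coe_ne_top_iff_summable, hsum, not_not, eq_top_iff,
      ← ENNReal.tsum_const_eq_top_of_ne_zero (α := ℕ) (c := 1) one_ne_zero]
    refine ENNReal.tsum_le_tsum fun j => ?_
    have : 1 ≤ (R j : ℝ≥0) * g (halfPow (ν j)) := by
      rw [← div_le_iff₀ (hgν j)]
      exact Nat.le_ceil _
    exact_mod_cast this

theorem absDiff_le_sum (v : ℕ → I) (m : ℕ) :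
    (absDiff (v 0) (v m) : ℝ) ≤ ∑ i ∈ Finset.range m, (absDiff (v i) (v (i + 1)) : ℝ) := by
  have h := dist_le_range_sum_dist (fun i => (v i : ℝ)) m
  simp only [Real.dist_eq] at h
  simpa only [absDiff, abs_sub_comm] using h

/-- A gauge need not be convex, but `g d ≥ (d / s - 1) * g s` for every `d`. With `s` half the
average step needed, the terms `d / s` add up to at least `2ⁿ⁺¹`, of which the `2ⁿ` subtracted ones
leave `2ⁿ`. -/
theorem IsGauge.mul_le_sum_path (hg : IsGauge g) (n : ℕ) (v : ℕ → I) :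
    2 ^ n * g (halfPow (n + 1) * absDiff (v 0) (v (2 ^ n))) ≤
      ∑ i ∈ Finset.range (2 ^ n), g (absDiff (v i) (v (i + 1))) := by
  set D := absDiff (v 0) (v (2 ^ n)) with hD
  by_cases hD0 : D = 0
  · rw [hD0, mul_zero, hg.map_zero, mul_zero]
    exact zero_le
  set s := halfPow (n + 1) * D with hs
  have hDpos : (0 : ℝ) < D := lt_of_le_of_ne D.2.1 (fun h => hD0 (Subtype.ext h.symm))
  have hsD : (s : ℝ) = D / 2 ^ (n + 1) := by
    rw [hs, Set.Icc.coe_mul, coe_halfPow]; ring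
  have hspos : (0 : ℝ) < s := by rw [hsD]; positivity
  have key : ∀ d : I, ((d : ℝ) / s - 1) * g s ≤ g d := by
    intro d
    rcases le_total d s with hds | hds
    · have : (d : ℝ) / s ≤ 1 := (div_le_one hspos).2 hds
      exact (mul_nonpos_of_nonpos_of_nonneg (by linarith) (g s).2).trans (g d).2
    · have hd0 : (0 : ℝ) < d := hspos.trans_le hds
      have h1 := hg.le_mul_of_le hds (fun h => by simp [h] at hd0)
      have h2 : (d : ℝ) / s * g s ≤ g d := by
        calc (d : ℝ) / s * g s ≤ d / s * (s / d * g d) := by gcongr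
          _ = g d := by field_simp
      nlinarith [(g s).2]
  have h1 := Finset.sum_le_sum fun i (_ : i ∈ Finset.range (2 ^ n)) =>
    key (absDiff (v i) (v (i + 1)))
  rw [← Finset.sum_mul, Finset.sum_sub_distrib, ← Finset.sum_div] at h1
  have h2 : (2 : ℝ) ^ (n + 1) ≤
      (∑ i ∈ Finset.range (2 ^ n), (absDiff (v i) (v (i + 1)) : ℝ)) / s := by
    rw [le_div_iff₀ hspos, hsD, mul_div_cancel₀ _ (by positivity)]
    exact absDiff_le_sum v (2 ^ n)
  rw [← NNReal.coe_le_coe]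
  push_cast
  refine le_trans ?_ h1
  refine mul_le_mul_of_nonneg_right ?_ (g s).2
  simp only [Finset.sum_const, Finset.card_range, nsmul_eq_mul, mul_one]
  push_cast
  rw [pow_succ] at h2
  linarith

/-- Supermultiplicativity splits `g(2⁻ⁿ⁻¹ D)` into `g(2⁻ⁿ) * g D` up to a constant; after summing
over the coordinates in `s`, some step is at least the average. -/
theorem IsGauge.exists_step (hg : IsGauge g) : ∃ A : ℝ≥0, ∀ (n : ℕ) (s : Finset ℕ)
    (u : ℕ → ℕ → I), ∃ i < 2 ^ n,
      g (halfPow n) * partSum g s (u 0) (u (2 ^ n)) ≤ A * partSum g s (u i) (u (i + 1)) := by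
  obtain ⟨K, hK⟩ := hg.supermul
  obtain ⟨L, hL⟩ := hg.exists_le_mul_halfPow 1
  refine ⟨L * K, fun n s u => ?_⟩
  have h1 : ∑ _i ∈ Finset.range (2 ^ n), g (halfPow n) * partSum g s (u 0) (u (2 ^ n)) ≤
      ∑ i ∈ Finset.range (2 ^ n), L * K * partSum g s (u i) (u (i + 1)) := by
    rw [Finset.sum_const, Finset.card_range, nsmul_eq_mul, ← Finset.mul_sum]
    simp only [partSum]
    rw [Finset.sum_comm, Finset.mul_sum, Finset.mul_sum, Finset.mul_sum]
    refine Finset.sum_le_sum fun c _ => ?_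
    calc _ ≤ ((2 ^ n : ℕ) : ℝ≥0) * ((L * g (halfPow (n + 1))) *
          g (absDiff (u 0 c) (u (2 ^ n) c))) := by
          refine mul_le_mul' le_rfl (mul_le_mul' ?_ le_rfl)
          refine (hL _).trans ?_
          rw [← halfPow_add, add_comm]
      _ = L * (2 ^ n * (g (halfPow (n + 1)) * g (absDiff (u 0 c) (u (2 ^ n) c)))) := by
          push_cast
          ring
      _ ≤ L * (2 ^ n * (K * g (halfPow (n + 1) * absDiff (u 0 c) (u (2 ^ n) c)))) :=
          mul_le_mul' le_rfl (mul_le_mul' le_rfl (hK _ _))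
      _ = L * K * (2 ^ n * g (halfPow (n + 1) * absDiff (u 0 c) (u (2 ^ n) c))) := by ring
      _ ≤ _ := mul_le_mul' le_rfl (hg.mul_le_sum_path n fun i => u i c)
  obtain ⟨i, hi, h2⟩ := Finset.exists_le_of_sum_le ⟨0, by simp⟩ h1
  exact ⟨i, Finset.mem_range.1 hi, h2⟩

/-- The dyadic point of `[0,1]` coded by a natural number. -/
noncomputable def dyadicPoint (c : ℕ) : I :=
  Set.projIcc (0 : ℝ) 1 zero_le_one ((Nat.unpair c).1 / 2 ^ (Nat.unpair c).2)

theorem coe_dyadicPoint {i n : ℕ} (h : i ≤ 2 ^ n) :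
    (dyadicPoint (Nat.pair i n) : ℝ) = i / 2 ^ n := by
  have h1 : (i : ℝ) / 2 ^ n ∈ Set.Icc (0 : ℝ) 1 :=
    ⟨by positivity, (div_le_one (by positivity)).2 (by exact_mod_cast h)⟩
  rw [dyadicPoint, Nat.unpair_pair, Set.projIcc_of_mem _ h1]

theorem absDiff_dyadicPoint_succ {i n : ℕ} (h : i < 2 ^ n) :
    absDiff (dyadicPoint (Nat.pair i n)) (dyadicPoint (Nat.pair (i + 1) n)) = halfPow n := by
  ext
  simp only [absDiff]
  rw [coe_dyadicPoint h.le, coe_dyadicPoint h, ← sub_div, coe_halfPow]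
  simp

theorem absDiff_dyadicPoint_zero (n : ℕ) :
    absDiff (dyadicPoint (Nat.pair 0 n)) (dyadicPoint (Nat.pair (2 ^ n) n)) = 1 := by
  ext
  simp only [absDiff]
  rw [coe_dyadicPoint (zero_le), coe_dyadicPoint le_rfl]
  simp

/-- A Borel reduction of `E_f` to `E_g` yields finite blocks of coordinates on which dyadic paths
of length `2 ^ μ k` are mapped, with matching convergence behaviour. -/
theorem exists_block_maps (hf : IsGauge f) (hg : IsGauge g)
    (h : BorelReducible (ERel f) (ERel g)) (μ : ℕ → ℕ) :
    ∃ (s : ℕ → Finset ℕ) (T : ℕ → ℕ → ℕ → I), ∀ p q : ℕ → ℕ, (∀ k, p k ≤ 2 ^ μ k) →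
      (∀ k, q k ≤ 2 ^ μ k) →
      ((Summable fun k => f (absDiff (dyadicPoint (Nat.pair (p k) (μ k)))
        (dyadicPoint (Nat.pair (q k) (μ k))))) ↔
      Summable fun k => partSum g (s k) (T k (p k)) (T k (q k))) := by
  obtain ⟨θ, hθ, hred⟩ := h
  -- Composing with `dyadicPoint` moves the reduction to Baire space; codes carry the denominator
  -- exponent, so each coordinate ranges over a finite set of codes.
  have hm : Measurable fun (x : ℕ → ℕ) (k : ℕ) => dyadicPoint (x k) :=
    measurable_pi_lambda _ fun k => (Measurable.of_discrete (f := dyadicPoint)).comp (measurable_pi_apply k)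
  obtain ⟨N, hN, w, l, K, hl0, hl, hmod⟩ := exists_modular (hθ.comp hm) hg (fun x y hxy => by
    refine (hred _ _).1 (summable_of_hasFiniteSupport ?_)
    have h1 : Set.Finite {n | ¬ x n = y n} := by
      rw [← Nat.cofinite_eq_atTop] at hxy
      exact hxy
    refine h1.subset fun n hn hxn => hn ?_
    simp only [hxn, absDiff_self, hf.map_zero]) (fun k => Nat.pair (2 ^ μ k) (μ k))
  obtain ⟨Q, hQ⟩ := hg.exists_partSum_le
  let code : (ℕ → ℕ) → ℕ → ℕ := fun p k => Nat.pair (p k) (μ k)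
  let X : (ℕ → ℕ) → ℕ → I := fun p => θ fun n => dyadicPoint (N.extend (code p) w n)
  let s : ℕ → Finset ℕ := fun k => Finset.Ico (l k) (l (k + 1))
  have hcode : ∀ p : ℕ → ℕ, (∀ k, p k ≤ 2 ^ μ k) →
      code p ≤ fun k => Nat.pair (2 ^ μ k) (μ k) := fun p hp k => by
    rcases (hp k).lt_or_eq with h1 | h1
    · exact (Nat.pair_lt_pair_left _ h1).le
    · simp only [code, h1, le_refl]
  have hX : ∀ p q : ℕ → ℕ, (∀ k, p k ≤ 2 ^ μ k) → (∀ k, q k ≤ 2 ^ μ k) → ∀ k, p k = q k →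
      partSum g (s k) (X p) (X q) ≤ K * (1 / 2) ^ k := fun p q hp hq k hpq =>
    hmod _ _ (hcode p hp) (hcode q hq) k (by simp only [code, hpq])
  have hgeo : Summable fun k : ℕ => K * (1 / 2 : ℝ≥0) ^ k :=
    (NNReal.summable_geometric (by rw [← NNReal.coe_lt_coe]; norm_num)).mul_left _
  -- A standard sequence with entry `i` at `k` and `0` elsewhere: by modularity, block `k` of the
  -- image depends on the other entries only up to `K * 2⁻ᵏ`.
  let S : ℕ → ℕ → ℕ → ℕ := fun k i k' => if k' = k then min i (2 ^ μ k') else 0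
  have hS : ∀ k i k', S k i k' ≤ 2 ^ μ k' := fun k i k' => by
    simp only [S]
    split_ifs
    · exact min_le_right _ _
    · exact Nat.zero_le _
  have hSk : ∀ k i, i ≤ 2 ^ μ k → S k i k = i := fun k i hi => by simp [S, hi]
  refine ⟨s, fun k i => X (S k i), fun p q hp hq => ?_⟩
  have h1 : ERel g (X p) (X q) ↔ Summable fun k => f (absDiff (dyadicPoint (Nat.pair (p k) (μ k)))
      (dyadicPoint (Nat.pair (q k) (μ k)))) := by
    rw [← hred, ERel, ← hN.summable_iff]
    · simp only [Function.comp_def, hN.extend_apply, code]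
    · intro n hn
      have hn' : ¬ ∃ a, N a = n := hn
      rw [Function.extend_apply' _ _ _ hn', Function.extend_apply' _ _ _ hn', absDiff_self,
        hf.map_zero]
  rw [← h1, ERel, ← NNReal.summable_sum_Ico_iff hl0 hl]
  change (Summable fun k => partSum g (s k) (X p) (X q)) ↔ _
  have hpS : ∀ k, partSum g (s k) (X p) (X (S k (p k))) ≤ K * (1 / 2) ^ k := fun k =>
    hX _ _ hp (hS _ _) k (hSk k _ (hp k)).symm
  have hqS : ∀ k, partSum g (s k) (X q) (X (S k (q k))) ≤ K * (1 / 2) ^ k := fun k =>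
    hX _ _ hq (hS _ _) k (hSk k _ (hq k)).symm
  have four : ∀ (k : ℕ) (a b c d : ℕ → I), partSum g (s k) a b ≤ K * (1 / 2) ^ k →
      partSum g (s k) c d ≤ K * (1 / 2) ^ k → partSum g (s k) a c ≤
        Q * (K * (1 / 2) ^ k + Q * (partSum g (s k) b d + K * (1 / 2) ^ k)) := by
    intro k a b c d hab hcd
    refine (hQ _ a b c).trans (mul_le_mul' le_rfl (add_le_add hab ?_))
    refine (hQ _ b d c).trans (mul_le_mul' le_rfl (add_le_add le_rfl ?_))
    rwa [partSum_comm]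
  constructor <;> intro hs
  · refine NNReal.summable_of_le (fun k => four k _ (X p) _ (X q) ?_ ?_)
      ((hgeo.add ((hs.add hgeo).mul_left Q)).mul_left Q)
    · rw [partSum_comm]; exact hpS k
    · rw [partSum_comm]; exact hqS k
  · exact NNReal.summable_of_le (fun k => four k _ _ _ _ (hpS k) (hqS k))
      ((hgeo.add ((hs.add hgeo).mul_left Q)).mul_left Q)

/-- Sequences that differ by one short step in each coordinate are `E_f`-equivalent; their summable
images bound `∑ g(2⁻ᵘ) * (endpoint displacement)`, although `∑ g(2⁻ᵘ)` diverges. -/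
theorem exists_le_mul_of_borelReducible (hf : IsGauge f) (hg : IsGauge g)
    (h : BorelReducible (ERel f) (ERel g)) :
    ∃ C : ℝ≥0, ∀ n, g (halfPow n) ≤ C * f (halfPow n) := by
  by_contra! hC
  obtain ⟨μ, hμf, hμg⟩ := exists_summable_not_summable hg hC
  obtain ⟨s, T, hT⟩ := exists_block_maps hf hg h μ
  obtain ⟨A, hA⟩ := hg.exists_step
  choose i hi hiA using fun k => hA (μ k) (s k) (T k)
  have h1 : Summable fun k => partSum g (s k) (T k (i k)) (T k (i k + 1)) := by
    rw [← hT i (fun k => i k + 1) (fun k => (hi k).le) (fun k => hi k)]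
    simpa only [absDiff_dyadicPoint_succ (hi _)] using hμf
  have h2 : Summable fun k => g (halfPow (μ k)) * partSum g (s k) (T k 0) (T k (2 ^ μ k)) :=
    NNReal.summable_of_le hiA (h1.mul_left A)
  -- Displacements bounded below would make `∑ g(2⁻ᵘ)` converge. Otherwise, jumping from `0` to `1`
  -- along a sparse subsequence gives equivalent images of inequivalent sequences.
  by_cases h3 : ∃ ε : ℝ≥0, 0 < ε ∧ ∀ᶠ k in atTop, ε ≤ partSum g (s k) (T k 0) (T k (2 ^ μ k))
  · obtain ⟨ε, hε, h3⟩ := h3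
    obtain ⟨n, hn⟩ := eventually_atTop.1 h3
    refine hμg ((NNReal.summable_nat_add_iff n).1 (NNReal.summable_of_le (fun k => ?_)
      (((NNReal.summable_nat_add_iff n).2 h2).mul_right ε⁻¹)))
    rw [← div_eq_mul_inv, le_div_iff₀ hε]
    exact mul_le_mul' le_rfl (hn _ (Nat.le_add_left _ _))
  · push Not at h3
    obtain ⟨ψ, hψ, hψT⟩ := extraction_forall_of_frequently
      (P := fun n k => partSum g (s k) (T k 0) (T k (2 ^ μ k)) < (1 / 2) ^ n)
      fun n => by simpa using h3 ((1 / 2) ^ n) (by positivity)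
    classical
    let q : ℕ → ℕ := fun k => if k ∈ Set.range ψ then 2 ^ μ k else 0
    have hq : ∀ k, q k ≤ 2 ^ μ k := fun k => by
      simp only [q]
      split_ifs
      · exact le_rfl
      · exact Nat.zero_le _
    have hqψ : ∀ n, q (ψ n) = 2 ^ μ (ψ n) := fun n => by simp [q]
    have h4 : Summable fun k => partSum g (s k) (T k 0) (T k (q k)) := by
      rw [← hψ.injective.summable_iff]
      · refine NNReal.summable_of_le (fun n => ?_)
          (NNReal.summable_geometric (r := 1 / 2) (by rw [← NNReal.coe_lt_coe]; norm_num))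
        simp only [Function.comp_def, hqψ]
        exact (hψT n).le
      · intro k hk
        simp only [q, hk, if_false, hg.partSum_self]
    rw [← hT (fun _ => 0) q (fun _ => Nat.zero_le _) hq] at h4
    have h5 := NNReal.summable_comp_injective h4 hψ.injective
    simp only [Function.comp_def, hqψ, absDiff_dyadicPoint_zero] at h5
    have h6 : Summable fun _ : ℕ => (f 1 : ℝ) := NNReal.summable_coe.2 h5
    rw [summable_const_iff] at h6
    exact (hf.pos 1 one_ne_zero).ne' (by exact_mod_cast h6)

end

/-! ### Iterated logarithms and weights -/

theorem coe_pos_of_ne_zero {x : I} (hx : x ≠ 0) : (0 : ℝ) < x :=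
  lt_of_le_of_ne x.2.1 fun h => hx (Subtype.ext h.symm)

theorem iterLog_pos (i : ℕ) (x : I) : 0 < iterLog i x :=
  zero_lt_one.trans_le (one_le_iterLog i x)

theorem one_add_logb_mono {s t : ℝ} (hs : 0 < s) (h : s ≤ t) :
    1 + Real.logb 2 s ≤ 1 + Real.logb 2 t := by
  have := (Real.logb_le_logb (b := 2) (by norm_num) hs (hs.trans_le h)).2 h
  linarith

theorem iterLog_anti (i : ℕ) {x y : I} (hx : x ≠ 0) (h : x ≤ y) : iterLog i y ≤ iterLog i x := by
  induction i with
  | zero =>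
    have h1 := coe_pos_of_ne_zero hx
    have := (Real.logb_le_logb (b := 2) (by norm_num) h1 (h1.trans_le h)).2 h
    simp only [iterLog]
    linarith
  | succ i ih => exact one_add_logb_mono (iterLog_pos i y) ih

theorem one_add_logb_mul_le {s t : ℝ} (hs : 1 ≤ s) (ht : 1 ≤ t) :
    1 + Real.logb 2 (s * t) ≤ (1 + Real.logb 2 s) * (1 + Real.logb 2 t) := by
  rw [Real.logb_mul (by linarith) (by linarith)]
  nlinarith [mul_nonneg (Real.logb_nonneg (b := 2) (by norm_num) hs)
    (Real.logb_nonneg (b := 2) (by norm_num) ht)]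

theorem iterLog_mul_le (i : ℕ) {x y : I} (hx : x ≠ 0) (hy : y ≠ 0) :
    iterLog i (x * y : I) ≤ iterLog i x * iterLog i y := by
  induction i with
  | zero =>
    have h1 := Real.logb_nonpos (b := 2) (by norm_num) x.2.1 x.2.2
    have h2 := Real.logb_nonpos (b := 2) (by norm_num) y.2.1 y.2.2
    simp only [iterLog]
    rw [Set.Icc.coe_mul, Real.logb_mul (coe_pos_of_ne_zero hx).ne' (coe_pos_of_ne_zero hy).ne']
    nlinarith
  | succ i ih =>
    exact (one_add_logb_mono (iterLog_pos i _) ih).trans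
      (one_add_logb_mul_le (one_le_iterLog i x) (one_le_iterLog i y))

theorem entry_mem {η : List ℝ} (hη : ∀ a ∈ η, a ∈ Set.Ico (0 : ℝ) 1) (i : ℕ) :
    entry η i ∈ Set.Ico (0 : ℝ) 1 := by
  unfold entry
  rw [List.getD_eq_getElem?_getD]
  by_cases h : i < η.length
  · rw [List.getElem?_eq_getElem h]
    exact hη _ (List.getElem_mem h)
  · rw [List.getElem?_eq_none (not_lt.1 h)]
    simp

theorem weight_pos (η : List ℝ) (x : I) : 0 < weight η x :=
  Finset.prod_pos fun i _ => Real.rpow_pos_of_pos (iterLog_pos i x) _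

theorem weight_anti {η : List ℝ} (hη : ∀ a ∈ η, a ∈ Set.Ico (0 : ℝ) 1) {x y : I} (hx : x ≠ 0)
    (h : x ≤ y) : weight η y ≤ weight η x :=
  Finset.prod_le_prod (fun i _ => Real.rpow_nonneg (iterLog_pos i y).le _) fun i _ =>
    Real.rpow_le_rpow (iterLog_pos i y).le (iterLog_anti i hx h) (entry_mem hη i).1

theorem weight_mul_le {η : List ℝ} (hη : ∀ a ∈ η, a ∈ Set.Ico (0 : ℝ) 1) {x y : I} (hx : x ≠ 0)
    (hy : y ≠ 0) : weight η (x * y : I) ≤ weight η x * weight η y := by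
  rw [weight, weight, weight, ← Finset.prod_mul_distrib]
  refine Finset.prod_le_prod (fun i _ => Real.rpow_nonneg (iterLog_pos i _).le _) fun i _ => ?_
  rw [← Real.mul_rpow (iterLog_pos i x).le (iterLog_pos i y).le]
  exact Real.rpow_le_rpow (iterLog_pos i _).le (iterLog_mul_le i hx hy) (entry_mem hη i).1

theorem weight_eq_prod_range (η : List ℝ) (x : ℝ) {L : ℕ} (hL : η.length ≤ L) :
    weight η x = ∏ i ∈ Finset.range L, iterLog i x ^ entry η i := by
  refine Finset.prod_subset (Finset.range_mono hL) fun i _ hi => ?_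
  have : entry η i = 0 := List.getD_eq_default _ _ (by simpa using hi)
  rw [this, Real.rpow_zero]

theorem coe_modFun (α : ℝ) (η : List ℝ) (φ : I → ℝ≥0) {x : I} (hx : x ≠ 0) :
    (modFun α η φ x : ℝ) = (x : ℝ) ^ α * φ x / weight η x := by
  have h : invWeight η x = NNReal.mk (1 / weight η x) (one_div_nonneg.2 (weight_nonneg η x)) :=
    if_neg hx
  rw [modFun, h, NNReal.coe_mul, NNReal.coe_mul]
  exact mul_one_div _ _

theorem modFun_zero {α : ℝ} (hα : 1 ≤ α) (η : List ℝ) (φ : I → ℝ≥0) : modFun α η φ 0 = 0 := by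
  have : idPow α 0 = 0 := Subtype.ext (Real.zero_rpow (by linarith : α ≠ 0))
  rw [modFun, this, zero_mul, zero_mul]

theorem baseFun_eq_modFun (α : ℝ) (η : List ℝ) : baseFun α η = modFun α η 1 := by
  ext x
  simp [baseFun, modFun]

/-- Star-shapedness combines `t ^ α ≤ t`, from `1 ≤ α`, with the monotonicity of `φ` and of `1 /
l_η`; supermultiplicativity uses that the weight is submultiplicative. -/
theorem isGauge_modFun {α : ℝ} (hα : 1 ≤ α) {η : List ℝ} (hη : ∀ a ∈ η, a ∈ Set.Ico (0 : ℝ) 1)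
    {φ : I → ℝ≥0} (hφ : Monotone φ) (hpos : ∀ x, x ≠ 0 → 0 < φ x)
    (hmul : ∃ K : ℝ≥0, ∀ x y, x ≠ 0 → y ≠ 0 → φ x * φ y ≤ K * φ (x * y)) :
    IsGauge (modFun α η φ) := by
  refine ⟨fun x hx => ?_, fun t x => ?_, ?_⟩
  · rw [← NNReal.coe_pos, coe_modFun _ _ _ hx]
    exact div_pos (mul_pos (Real.rpow_pos_of_pos (coe_pos_of_ne_zero hx) _) (hpos x hx))
      (weight_pos η x)
  · by_cases ht : t = 0
    · simp [ht, modFun_zero hα]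
    by_cases hx : x = 0
    · simp [hx, modFun_zero hα]
    have htx : t * x ≠ 0 := mul_ne_zero ht hx
    have hle : t * x ≤ x := unitInterval.mul_le_right
    rw [coe_modFun _ _ _ hx, coe_modFun _ _ _ htx, Set.Icc.coe_mul, Real.mul_rpow t.2.1 x.2.1]
    have h1 : (t : ℝ) ^ α ≤ t := by
      simpa using Real.rpow_le_rpow_of_exponent_ge (coe_pos_of_ne_zero ht) t.2.2 hα
    have h2 : (φ (t * x) : ℝ) ≤ φ x := hφ hle
    have h3 := weight_anti hη htx hle
    rw [← mul_div_assoc, ← mul_assoc]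
    have := weight_pos η x
    have := x.2.1
    have := t.2.1
    have := Real.rpow_nonneg x.2.1 α
    rw [Set.Icc.coe_mul] at h3
    gcongr
  · obtain ⟨K, hK⟩ := hmul
    refine ⟨K, fun x y => ?_⟩
    by_cases hx : x = 0
    · simp [hx, modFun_zero hα]
    by_cases hy : y = 0
    · simp [hy, modFun_zero hα]
    rw [← NNReal.coe_le_coe, NNReal.coe_mul, NNReal.coe_mul, coe_modFun _ _ _ hx,
      coe_modFun _ _ _ hy, coe_modFun _ _ _ (mul_ne_zero hx hy), Set.Icc.coe_mul,
      Real.mul_rpow x.2.1 y.2.1]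
    have h2 : (φ x : ℝ) * φ y ≤ K * φ (x * y) := by exact_mod_cast hK x y hx hy
    have h3 := weight_mul_le hη hx hy
    have h4 := weight_pos η (x * y)
    have h5 : (0 : ℝ) ≤ (x : ℝ) ^ α * (y : ℝ) ^ α :=
      mul_nonneg (Real.rpow_nonneg x.2.1 _) (Real.rpow_nonneg y.2.1 _)
    calc (x : ℝ) ^ α * φ x / weight η x * ((y : ℝ) ^ α * φ y / weight η y) =
          (x : ℝ) ^ α * (y : ℝ) ^ α * (φ x * φ y) / (weight η x * weight η y) := by
          field_simp
      _ ≤ (x : ℝ) ^ α * (y : ℝ) ^ α * (K * φ (x * y)) / weight η (x * y : I) := by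
          gcongr
      _ = _ := by rw [Set.Icc.coe_mul]; ring

theorem isGauge_baseFun {α : ℝ} (hα : 1 ≤ α) {η : List ℝ} (hη : ∀ a ∈ η, a ∈ Set.Ico (0 : ℝ) 1) :
    IsGauge (baseFun α η) := by
  rw [baseFun_eq_modFun]
  exact isGauge_modFun hα hη monotone_const (by simp) ⟨1, by simp⟩

theorem exists_one_add_logb_le {κ : ℝ} (hκ : 0 < κ) :
    ∃ C : ℝ, 0 < C ∧ ∀ s : ℝ, 1 ≤ s → 1 + Real.logb 2 s ≤ C * s ^ κ := by
  have h2 : 0 < Real.log 2 := Real.log_pos (by norm_num)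
  refine ⟨1 + 1 / (κ * Real.log 2), by positivity, fun s hs => ?_⟩
  have h1 := Real.log_le_rpow_div (zero_le_one.trans hs) hκ
  have h3 : 1 ≤ s ^ κ := Real.one_le_rpow hs hκ.le
  have h4 : Real.logb 2 s ≤ 1 / (κ * Real.log 2) * s ^ κ := by
    rw [Real.logb, div_le_iff₀ h2]
    refine h1.trans (le_of_eq ?_)
    field_simp
  linarith

theorem one_le_iterLog_div (i : ℕ) {x y : I} (hx : x ≠ 0) (h : x ≤ y) :
    1 ≤ iterLog i x / iterLog i y :=
  (one_le_div (iterLog_pos i y)).2 (iterLog_anti i hx h)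

theorem iterLog_succ_div_le (i : ℕ) {x y : I} (hx : x ≠ 0) (h : x ≤ y) :
    iterLog (i + 1) x / iterLog (i + 1) y ≤ 1 + Real.logb 2 (iterLog i x / iterLog i y) := by
  rw [div_le_iff₀' (iterLog_pos (i + 1) y)]
  have := one_add_logb_mul_le (one_le_iterLog i y) (one_le_iterLog_div i hx h)
  rwa [mul_div_cancel₀ _ (iterLog_pos i y).ne'] at this

/-- Submultiplicativity of `1 + logb 2` bounds the ratio at level `i + 1` by `1 + logb 2` of the
ratio at level `i`, and a logarithm is below any positive power. -/
theorem exists_iterLog_div_le {j i : ℕ} (hij : j < i) {κ : ℝ} (hκ : 0 < κ) :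
    ∃ C : ℝ, 0 < C ∧ ∀ x y : I, x ≠ 0 → x ≤ y →
      iterLog i x / iterLog i y ≤ C * (iterLog j x / iterLog j y) ^ κ := by
  induction i, hij using Nat.le_induction with
  | base =>
    obtain ⟨C, hC, h⟩ := exists_one_add_logb_le hκ
    exact ⟨C, hC, fun x y hx hxy => (iterLog_succ_div_le j hx hxy).trans
      (h _ (one_le_iterLog_div j hx hxy))⟩
  | succ i _ ih =>
    obtain ⟨C, hC, h⟩ := exists_one_add_logb_le one_pos
    obtain ⟨C', hC', h'⟩ := ih
    refine ⟨C * C', by positivity, fun x y hx hxy => ?_⟩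
    refine (iterLog_succ_div_le i hx hxy).trans ((h _ (one_le_iterLog_div i hx hxy)).trans ?_)
    rw [Real.rpow_one, mul_assoc]
    gcongr
    exact h' x y hx hxy

theorem iterLog_zero_halfPow (n : ℕ) : iterLog 0 (halfPow n) = 1 + n := by
  simp only [iterLog, coe_halfPow, one_div, Real.logb_inv, Real.logb_pow]
  simp

theorem iterLog_succ_halfPow_two_pow (i a : ℕ) :
    iterLog i (halfPow a) ≤ iterLog (i + 1) (halfPow (2 ^ a)) ∧
      iterLog (i + 1) (halfPow (2 ^ a)) ≤ iterLog i (halfPow a) + 1 := by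
  have hlog : ∀ t : ℝ, 1 ≤ t → 1 + Real.logb 2 (t + 1) ≤ 1 + Real.logb 2 t + 1 := fun t ht => by
    refine (one_add_logb_mono (by linarith) (by linarith : t + 1 ≤ t * 2)).trans (le_of_eq ?_)
    rw [Real.logb_mul (by linarith) (by norm_num), Real.logb_self_eq_one (by norm_num)]
    ring
  induction i with
  | zero =>
    have h1 : (1 : ℝ) ≤ 2 ^ a := one_le_pow₀ (by norm_num)
    have h2 : Real.logb 2 ((2 : ℝ) ^ a) = a := by
      rw [Real.logb_pow, Real.logb_self_eq_one (by norm_num), mul_one]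
    have h3 := one_add_logb_mono (by positivity) (by linarith : (2 : ℝ) ^ a ≤ 1 + 2 ^ a)
    have h4 := hlog _ h1
    rw [iterLog_zero_halfPow, iterLog.eq_2, iterLog_zero_halfPow]
    push_cast
    rw [h2] at h3 h4
    rw [add_comm ((2 : ℝ) ^ a)] at h4
    exact ⟨h3, h4⟩
  | succ i ih =>
    exact ⟨one_add_logb_mono (iterLog_pos i _) ih.1,
      (one_add_logb_mono (iterLog_pos (i + 1) _) ih.2).trans (hlog _ (one_le_iterLog i _))⟩

/-- Each exponential in `tower` undoes one logarithm of `iterLog`, and the summand `1` in `t_j` adds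
at most `1` to the error at each level. -/
theorem iterLog_halfPow_tower (j m : ℕ) :
    2 ^ (m + 1) ≤ iterLog j (halfPow (tower j m)) ∧
      iterLog j (halfPow (tower j m)) ≤ 2 ^ (m + 1) + 1 + j := by
  induction j with
  | zero =>
    rw [iterLog_zero_halfPow, tower]
    push_cast
    constructor <;> linarith
  | succ j ih =>
    obtain ⟨h1, h2⟩ := iterLog_succ_halfPow_two_pow j (tower j m)
    rw [tower]
    push_cast
    constructor <;> linarith

theorem tower_strictMono (j : ℕ) : StrictMono (tower j) := by
  induction j with
  | zero => exact fun m n h => Nat.pow_lt_pow_right (by norm_num) (Nat.succ_lt_succ h)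
  | succ j ih => exact fun m n h => Nat.pow_lt_pow_right (by norm_num) (ih h)

theorem two_mul_tower_le (j m : ℕ) : 2 * tower j m ≤ tower j (m + 1) := by
  cases j with
  | zero => simp only [tower]; rw [pow_succ 2 (m + 1), mul_comm]
  | succ j =>
    simp only [tower]
    rw [← pow_succ']
    exact Nat.pow_le_pow_right (by norm_num) (tower_strictMono j m.lt_succ_self)

/-- `M n` counts the thresholds `k m` that are at most `n`. -/
theorem StrictMono.exists_lt_iff_le {k : ℕ → ℕ} (hk : StrictMono k) :
    ∃ M : ℕ → ℕ, ∀ m n, m < M n ↔ k m ≤ n := by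
  have h : ∀ n, ∃ m, n < k m := fun n => ⟨n + 1, (Nat.lt_succ_self n).trans_le (hk.id_le _)⟩
  refine ⟨fun n => Nat.find (h n), fun m n => ?_⟩
  rw [Nat.lt_find_iff]
  exact ⟨fun h => not_lt.1 (h m le_rfl), fun hm i hi => not_lt.2 ((hk.monotone hi).trans hm)⟩

theorem two_pow_le_iterLog_halfPow {j : ℕ} {M : ℕ → ℕ} (hM : ∀ m n, m < M n ↔ tower j m ≤ n)
    (n : ℕ) : 2 ^ M n ≤ iterLog j (halfPow n) := by
  rcases Nat.eq_zero_or_pos (M n) with h | h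
  · rw [h, pow_zero]
    exact one_le_iterLog _ _
  · obtain ⟨m, hm⟩ := Nat.exists_eq_succ_of_ne_zero h.ne'
    have h1 := (hM m n).1 (by omega)
    rw [hm]
    exact (iterLog_halfPow_tower j m).1.trans
      (iterLog_anti j (halfPow_ne_zero n) (halfPow_antitone h1))

theorem iterLog_halfPow_le {j : ℕ} {M : ℕ → ℕ} (hM : ∀ m n, m < M n ↔ tower j m ≤ n)
    (n : ℕ) : iterLog j (halfPow n) ≤ (3 + j) * 2 ^ M n := by
  have h1 : n < tower j (M n) := not_le.1 fun h => lt_irrefl _ ((hM _ _).2 h)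
  have h2 := (iterLog_anti j (halfPow_ne_zero _) (halfPow_antitone h1.le)).trans
    (iterLog_halfPow_tower j (M n)).2
  have h3 : (1 : ℝ) ≤ 2 ^ M n := one_le_pow₀ (by norm_num)
  rw [pow_succ] at h2
  have h4 : (j : ℝ) ≤ j * 2 ^ M n := le_mul_of_one_le_right (Nat.cast_nonneg j) h3
  linarith

/-! ### The step sequences `u_U` -/

open Classical in
/-- The indices `m ∈ ⋃ l ∈ U, I_l` with `k m ≤ n`. -/
noncomputable def stepSet (k : ℕ → ℕ) (U : Set ℕ) (n : ℕ) : Finset ℕ :=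
  (Finset.range (n + 1)).filter fun m => (∃ l ∈ U, m ∈ block l) ∧ k m ≤ n

section

variable {k : ℕ → ℕ} {δ : ℝ} {U V : Set ℕ}

theorem mem_stepSet (hk : StrictMono k) {m n : ℕ} :
    m ∈ stepSet k U n ↔ (∃ l ∈ U, m ∈ block l) ∧ k m ≤ n := by
  simp only [stepSet, Finset.mem_filter, Finset.mem_range, and_iff_right_iff_imp]
  exact fun h => Nat.lt_succ_of_le ((hk.id_le m).trans h.2)

theorem stepSet_mono (hk : StrictMono k) : Monotone (stepSet k U) := fun n n' h m hm => by
  rw [mem_stepSet hk] at hm ⊢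
  exact ⟨hm.1, hm.2.trans h⟩

theorem stepSeq_eq_pow (hk : StrictMono k) (h0 : 0 < k 0) (n : ℕ) :
    stepSeq k δ U n = δ ^ (stepSet k U n).card := by
  induction n with
  | zero =>
    have : stepSet k U 0 = ∅ := Finset.eq_empty_of_forall_notMem fun m hm => by
      have h1 := ((mem_stepSet hk).1 hm).2
      have h2 := hk.monotone m.zero_le
      omega
    rw [this, Finset.card_empty, pow_zero, stepSeq]
  | succ n ih =>
    rw [stepSeq, ih]
    split_ifs with h
    · obtain ⟨l, hl, m, hm, hmn⟩ := h
      have h1 : stepSet k U (n + 1) = insert m (stepSet k U n) := by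
        ext i
        rw [Finset.mem_insert, mem_stepSet hk, mem_stepSet hk]
        constructor
        · rintro ⟨hi, hin⟩
          rcases hin.lt_or_eq with h2 | h2
          · exact Or.inr ⟨hi, Nat.lt_succ_iff.1 h2⟩
          · exact Or.inl (hk.injective (h2.trans hmn))
        · rintro (rfl | ⟨hi, hin⟩)
          · exact ⟨⟨l, hl, hm⟩, hmn.ge⟩
          · exact ⟨hi, hin.trans n.le_succ⟩
      have h2 : m ∉ stepSet k U n := fun h => by
        have := ((mem_stepSet hk).1 h).2
        omega
      rw [h1, Finset.card_insert_of_notMem h2, pow_succ']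
    · congr 2
      ext i
      rw [mem_stepSet hk, mem_stepSet hk]
      constructor
      · rintro ⟨hi, hin⟩
        exact ⟨hi, hin.trans n.le_succ⟩
      · rintro ⟨hi, hin⟩
        rcases hin.lt_or_eq with h2 | h2
        · exact ⟨hi, Nat.lt_succ_iff.1 h2⟩
        · obtain ⟨l, hl, hil⟩ := hi
          exact absurd ⟨l, hl, i, hil, h2.symm⟩ h

theorem stepSeq_pos (hδ : 0 < δ) (n : ℕ) : 0 < stepSeq k δ U n := by
  induction n with
  | zero => exact one_pos
  | succ n ih =>
    rw [stepSeq]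
    split_ifs
    exacts [mul_pos hδ ih, ih]

theorem stepSeq_antitone (hδ : 0 < δ) (hδ1 : δ < 1) : Antitone (stepSeq k δ U) :=
  antitone_nat_of_succ_le fun n => by
    rw [stepSeq]
    split_ifs
    exacts [mul_le_of_le_one_left (stepSeq_pos hδ n).le hδ1.le, le_rfl]

/-- Even if every threshold in `(n, n']` is a jump, there are only `M n' - M n` of them. -/
theorem stepSeq_mul_pow_le (hk : StrictMono k) (h0 : 0 < k 0) (hδ : 0 < δ) (hδ1 : δ < 1)
    {M : ℕ → ℕ} (hM : ∀ m n, m < M n ↔ k m ≤ n) {n n' : ℕ} :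
    stepSeq k δ U n * δ ^ (M n' - M n) ≤ stepSeq k δ U n' := by
  rw [stepSeq_eq_pow hk h0, stepSeq_eq_pow hk h0, ← pow_add]
  refine pow_le_pow_of_le_one hδ.le hδ1.le ?_
  have h1 : stepSet k U n' ⊆ stepSet k U n ∪ Finset.Ico (M n) (M n') := fun m hm => by
    rw [mem_stepSet hk] at hm
    rw [Finset.mem_union, mem_stepSet hk, Finset.mem_Ico, ← hM]
    rcases lt_or_ge m (M n) with h2 | h2
    · exact Or.inl ⟨hm.1, h2⟩
    · exact Or.inr ⟨h2, (hM _ _).2 hm.2⟩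
  refine (Finset.card_le_card h1).trans ((Finset.card_union_le _ _).trans ?_)
  rw [Nat.card_Ico]

theorem le_add_two_of_two_mul_le (h2k : ∀ m, 2 * k m ≤ k (m + 1)) {M : ℕ → ℕ}
    (hM : ∀ m n, m < M n ↔ k m ≤ n) (n : ℕ) : M (2 * n + 2) ≤ M n + 2 := by
  by_contra! h
  have h1 := (hM _ _).1 h
  have h2 : n < k (M n) := not_le.1 fun h => lt_irrefl _ ((hM _ _).2 h)
  have h3 := h2k (M n)
  have h4 : 2 * k (M n + 1) ≤ k (M n + 2) := h2k (M n + 1)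
  omega

/-- For `m ≤ n` the target index is at most `2n + 2`, and as thresholds at least double, at most two
lie in `(n, 2n + 2]`. The shift by `2` allows for rounding two arguments down to dyadic points. -/
theorem stepSeq_mul_le (hk : StrictMono k) (h0 : 0 < k 0) (h2k : ∀ m, 2 * k m ≤ k (m + 1))
    (hδ : 0 < δ) (hδ1 : δ < 1) (m n : ℕ) :
    δ ^ 2 * (stepSeq k δ U m * stepSeq k δ U n) ≤ stepSeq k δ U (m + n + 2) := by
  wlog h : m ≤ n generalizing m n
  · rw [mul_comm (stepSeq k δ U m), add_comm m]
    exact this n m (le_of_not_ge h)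
  obtain ⟨M, hM⟩ := hk.exists_lt_iff_le
  have h1 : stepSeq k δ U m ≤ 1 := stepSeq_antitone hδ hδ1 m.zero_le
  have h2 := stepSeq_mul_pow_le (U := U) hk h0 hδ hδ1 hM (n := n) (n' := 2 * n + 2)
  have h3 := le_add_two_of_two_mul_le h2k hM n
  have h4 : δ ^ 2 ≤ δ ^ (M (2 * n + 2) - M n) := pow_le_pow_of_le_one hδ.le hδ1.le (by omega)
  have h5 := stepSeq_pos (k := k) (U := U) hδ n
  have h6 := stepSeq_pos (k := k) (U := U) hδ m
  have h7 : 0 ≤ stepSeq k δ U m * stepSeq k δ U n := (mul_pos h6 h5).le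
  calc δ ^ 2 * (stepSeq k δ U m * stepSeq k δ U n) ≤
        δ ^ (M (2 * n + 2) - M n) * (1 * stepSeq k δ U n) := by gcongr
    _ = stepSeq k δ U n * δ ^ (M (2 * n + 2) - M n) := by ring
    _ ≤ _ := h2
    _ ≤ _ := stepSeq_antitone hδ hδ1 (by omega)

end

theorem tower_zero_pos (j : ℕ) : 0 < tower j 0 := by
  cases j <;> simp [tower]

/-! ### Growth of `f_U` against the upper function -/

section

variable {α δ : ℝ} {η η' : List ℝ} {j : ℕ} {U V : Set ℕ} {φ ψ : I → ℝ≥0}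

theorem isGauge_modFun_of_stepSeq (hα : 1 ≤ α) (hη : ∀ a ∈ η, a ∈ Set.Ico (0 : ℝ) 1)
    (hδ : 0 < δ) (hδ1 : δ < 1) (hφ : Monotone φ)
    (hφU : ∀ n, (φ (halfPow n) : ℝ) = stepSeq (tower j) δ U n) : IsGauge (modFun α η φ) := by
  refine isGauge_modFun hα hη hφ (fun x hx => ?_) ⟨(Real.toNNReal δ ^ 2)⁻¹, fun x y hx hy => ?_⟩
  · obtain ⟨n, hn, -⟩ := exists_halfPow_near hx
    refine lt_of_lt_of_le ?_ (hφ hn)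
    rw [← NNReal.coe_pos, hφU]
    exact stepSeq_pos hδ _
  · obtain ⟨m, hm, hm'⟩ := exists_halfPow_near hx
    obtain ⟨n, hn, hn'⟩ := exists_halfPow_near hy
    have hδ' : 0 < Real.toNNReal δ := Real.toNNReal_pos.2 hδ
    have h1 : halfPow (m + n + 2) ≤ x * y := by
      rw [show m + n + 2 = (m + 1) + (n + 1) by ring, halfPow_add]
      exact mul_le_mul' hm hn
    have h2 : Real.toNNReal δ ^ 2 * (φ (halfPow m) * φ (halfPow n)) ≤
        φ (halfPow (m + n + 2)) := by
      rw [← NNReal.coe_le_coe]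
      push_cast
      rw [Real.coe_toNNReal _ hδ.le, hφU, hφU, hφU]
      exact stepSeq_mul_le (tower_strictMono j) (tower_zero_pos j) (two_mul_tower_le j) hδ hδ1 m n
    rw [inv_mul_eq_div, le_div_iff₀ (by positivity), mul_comm]
    exact (mul_le_mul' le_rfl (mul_le_mul' (hφ hm') (hφ hn'))).trans (h2.trans (hφ h1))

/-- The reciprocal of the growth of the stepped weight is controlled by `t_j`. -/
theorem exists_rpow_bound {j : ℕ} {M : ℕ → ℕ} (hM : ∀ m n, m < M n ↔ tower j m ≤ n)
    (hδ : 0 < δ) (hδ1 : δ < 1) {n n' : ℕ} (h : n ≤ n') :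
    1 ≤ ((3 + j : ℝ) ^ (-Real.logb 2 δ)) *
      (iterLog j (halfPow n') / iterLog j (halfPow n)) ^ (-Real.logb 2 δ) *
        δ ^ (M n' - M n) := by
  have hβ : 0 < -Real.logb 2 δ := neg_pos.2 (Real.logb_neg (by norm_num) hδ hδ1)
  set ρ := iterLog j (halfPow n') / iterLog j (halfPow n) with hρ
  have h1 : (2 : ℝ) ^ (M n' - M n) ≤ (3 + j) * ρ := by
    have hMm : M n ≤ M n' := by
      by_contra! hlt
      exact lt_irrefl _ ((hM _ _).2 (((hM _ _).1 hlt).trans h))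
    rw [hρ, mul_div_assoc', le_div_iff₀ (iterLog_pos _ _)]
    calc (2 : ℝ) ^ (M n' - M n) * iterLog j (halfPow n) ≤
          2 ^ (M n' - M n) * ((3 + j) * 2 ^ M n) := by
          gcongr
          exact iterLog_halfPow_le hM n
      _ = (3 + j) * 2 ^ M n' := by
          rw [mul_left_comm, ← pow_add, Nat.sub_add_cancel hMm]
      _ ≤ _ := by
          gcongr
          exact two_pow_le_iterLog_halfPow hM n'
  have hρ0 : 0 < ρ := div_pos (iterLog_pos _ _) (iterLog_pos _ _)
  rw [← Real.mul_rpow (by positivity) hρ0.le]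
  have h2 := Real.rpow_le_rpow (by positivity) h1 hβ.le
  have h3 : ((2 : ℝ) ^ (M n' - M n)) ^ (-Real.logb 2 δ) * δ ^ (M n' - M n) = 1 := by
    rw [← Real.rpow_natCast, ← Real.rpow_mul (by norm_num), mul_comm _ (-Real.logb 2 δ),
      Real.rpow_mul (by norm_num), Real.rpow_neg (by norm_num),
      Real.rpow_logb (by norm_num) (by norm_num) hδ, Real.rpow_natCast, ← mul_pow,
      inv_mul_cancel₀ hδ.ne', one_pow]
  rw [← h3]
  gcongr

/-- Places before `j` cancel; places after `j` have exponent below `1` and ratios below any power of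
the ratio at `j`. -/
theorem exists_prod_rpow_bound (hη : ∀ a ∈ η, a ∈ Set.Ico (0 : ℝ) 1)
    (hη' : ∀ a ∈ η', a ∈ Set.Ico (0 : ℝ) 1) (heq : ∀ i < j, entry η i = entry η' i)
    {κ : ℝ} (hκ : 0 < κ) {i : ℕ} (hi : i ≠ j) :
    ∃ C : ℝ, 0 < C ∧ ∀ n n', n ≤ n' →
      (iterLog i (halfPow n') / iterLog i (halfPow n)) ^ (entry η i - entry η' i) ≤
        C * (iterLog j (halfPow n') / iterLog j (halfPow n)) ^ κ := by
  rcases lt_or_gt_of_ne hi with h | h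
  · refine ⟨1, one_pos, fun n n' hn => ?_⟩
    rw [heq i h, sub_self, Real.rpow_zero, one_mul]
    exact Real.one_le_rpow (one_le_iterLog_div j (halfPow_ne_zero _) (halfPow_antitone hn)) hκ.le
  · obtain ⟨C, hC, hle⟩ := exists_iterLog_div_le h hκ
    refine ⟨C, hC, fun n n' hn => ?_⟩
    refine le_trans ?_ (hle _ _ (halfPow_ne_zero n') (halfPow_antitone hn))
    refine Real.rpow_le_self_of_one_le
      (one_le_iterLog_div i (halfPow_ne_zero _) (halfPow_antitone hn)) ?_
    linarith [(entry_mem hη i).2, (entry_mem hη' i).1]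

/-- The quotient of `f_U` by the upper function gains `ρ_j ^ (η'_j - η_j)`, loses at most `ρ_j ^
(-logb 2 δ)` through `u_U`, and loses small powers at later places. The surplus `ε` yields
reducibility and also its strictness. -/
theorem exists_weight_ratio_bound (hη : ∀ a ∈ η, a ∈ Set.Ico (0 : ℝ) 1)
    (hη' : ∀ a ∈ η', a ∈ Set.Ico (0 : ℝ) 1) (heq : ∀ i < j, entry η i = entry η' i)
    (hlt : entry η j < entry η' j) (hδ : (2 : ℝ) ^ (entry η j - entry η' j) < δ) (hδ1 : δ < 1)
    (U : Set ℕ) : ∃ C ε : ℝ, 0 < C ∧ 0 < ε ∧ ∀ n n', n ≤ n' →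
      stepSeq (tower j) δ U n / weight η (halfPow n) * weight η' (halfPow n) *
        (iterLog j (halfPow n') / iterLog j (halfPow n)) ^ ε ≤
        C * (stepSeq (tower j) δ U n' / weight η (halfPow n') * weight η' (halfPow n')) := by
  have hδ0 : 0 < δ := (Real.rpow_pos_of_pos (by norm_num) _).trans hδ
  obtain ⟨M, hM⟩ := (tower_strictMono j).exists_lt_iff_le
  set L := max η.length η'.length with hL
  have hjL : j < L := by
    by_contra! hle
    have h1 : entry η j = 0 := List.getD_eq_default _ _ ((le_max_left _ _).trans hle)
    have h2 : entry η' j = 0 := List.getD_eq_default _ _ ((le_max_right _ _).trans hle)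
    rw [h1, h2] at hlt
    exact lt_irrefl _ hlt
  set β := -Real.logb 2 δ with hβ
  set e := entry η' j - entry η j with he
  have hβe : β < e := by
    have := Real.logb_lt_logb (b := 2) (by norm_num) (Real.rpow_pos_of_pos (by norm_num) _) hδ
    rw [Real.logb_rpow (by norm_num) (by norm_num)] at this
    simp only [hβ, he]
    linarith
  -- The spare exponent `e - β` is split into `L + 1` shares: at most one for each place below `L`,
  -- and one kept as `ε`.
  set κ := (e - β) / (L + 1) with hκ
  have hκ0 : 0 < κ := div_pos (by linarith) (by positivity)
  choose! c hc0 hc using fun i (hi : i ≠ j) =>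
    exists_prod_rpow_bound hη hη' heq hκ0 hi
  set P := ∏ i ∈ (Finset.range L).erase j, c i with hP
  have hP0 : 0 < P := Finset.prod_pos fun i hi => hc0 i (Finset.ne_of_mem_erase hi)
  refine ⟨(3 + j : ℝ) ^ β * P, κ, by positivity, hκ0, fun n n' hn => ?_⟩
  set ρ : ℕ → ℝ := fun i => iterLog i (halfPow n') / iterLog i (halfPow n) with hρ
  have hρ1 : ∀ i, 1 ≤ ρ i := fun i =>
    one_le_iterLog_div i (halfPow_ne_zero _) (halfPow_antitone hn)
  have hρ0 : ∀ i, 0 < ρ i := fun i => zero_lt_one.trans_le (hρ1 i)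
  have hprod : weight η (halfPow n') / weight η (halfPow n) *
      (weight η' (halfPow n) / weight η' (halfPow n')) =
      ∏ i ∈ Finset.range L, ρ i ^ (entry η i - entry η' i) := by
    rw [weight_eq_prod_range η _ (le_max_left _ _), weight_eq_prod_range η _ (le_max_left _ _),
      weight_eq_prod_range η' _ (le_max_right _ _), weight_eq_prod_range η' _ (le_max_right _ _),
      ← Finset.prod_div_distrib, ← Finset.prod_div_distrib, ← Finset.prod_mul_distrib]
    refine Finset.prod_congr rfl fun i _ => ?_
    rw [Real.rpow_sub (hρ0 i), hρ, Real.div_rpow (iterLog_pos i _).le (iterLog_pos i _).le,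
      Real.div_rpow (iterLog_pos i _).le (iterLog_pos i _).le, div_div_eq_mul_div, mul_div_assoc]
  have hbound : ∏ i ∈ Finset.range L, ρ i ^ (entry η i - entry η' i) ≤
      P * ρ j ^ (-e + κ * L) := by
    rw [← Finset.mul_prod_erase _ _ (Finset.mem_range.2 hjL)]
    have h1 : ∏ i ∈ (Finset.range L).erase j, ρ i ^ (entry η i - entry η' i) ≤
        ∏ i ∈ (Finset.range L).erase j, c i * ρ j ^ κ :=
      Finset.prod_le_prod (fun i _ => Real.rpow_nonneg (hρ0 i).le _) fun i hi =>
        hc i (Finset.ne_of_mem_erase hi) n n' hn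
    rw [Finset.prod_mul_distrib, Finset.prod_const, ← hP, ← Real.rpow_natCast,
      ← Real.rpow_mul (hρ0 j).le] at h1
    have h2 : ρ j ^ (κ * (((Finset.range L).erase j).card : ℝ)) ≤ ρ j ^ (κ * L) := by
      refine Real.rpow_le_rpow_of_exponent_le (hρ1 j) ?_
      have : ((Finset.range L).erase j).card ≤ L :=
        (Finset.card_erase_le).trans (Finset.card_range L).le
      gcongr
    have h3 : entry η j - entry η' j = -e := by rw [he]; ring
    rw [h3, Real.rpow_add (hρ0 j)]
    have := Real.rpow_nonneg (hρ0 j).le (-e)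
    calc _ ≤ ρ j ^ (-e) * (P * ρ j ^ (κ * L)) := by
          gcongr
          exact h1.trans (by gcongr)
      _ = _ := by ring
  have hu := stepSeq_mul_pow_le (U := U) (tower_strictMono j) (tower_zero_pos j) hδ0 hδ1 hM
    (n := n) (n' := n')
  have hd := exists_rpow_bound hM hδ0 hδ1 hn
  rw [← hβ] at hd
  change 1 ≤ (3 + j : ℝ) ^ β * ρ j ^ β * δ ^ (M n' - M n) at hd
  have hu0 := stepSeq_pos (k := tower j) (U := U) hδ0 n
  have hus : stepSeq (tower j) δ U n ≤
      (3 + j : ℝ) ^ β * ρ j ^ β * stepSeq (tower j) δ U n' := by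
    have hnn : 0 ≤ (3 + j : ℝ) ^ β * ρ j ^ β :=
      mul_nonneg (by positivity) (Real.rpow_nonneg (hρ0 j).le _)
    calc stepSeq (tower j) δ U n ≤ stepSeq (tower j) δ U n *
          ((3 + j : ℝ) ^ β * ρ j ^ β * δ ^ (M n' - M n)) := le_mul_of_one_le_right hu0.le hd
      _ = (3 + j : ℝ) ^ β * ρ j ^ β * (stepSeq (tower j) δ U n * δ ^ (M n' - M n)) := by ring
      _ ≤ _ := mul_le_mul_of_nonneg_left hu hnn
  have hexp : ρ j ^ β * ρ j ^ (-e + κ * L) * ρ j ^ κ = 1 := by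
    rw [← Real.rpow_add (hρ0 j), ← Real.rpow_add (hρ0 j)]
    have : β + (-e + κ * L) + κ = 0 := by
      have : κ * (L + 1) = e - β := div_mul_cancel₀ _ (by positivity)
      linarith
    rw [this, Real.rpow_zero]
  have hw := weight_pos η (halfPow n)
  have hw' := weight_pos η (halfPow n')
  have hv := weight_pos η' (halfPow n)
  have hv' := weight_pos η' (halfPow n')
  have hu0' := stepSeq_pos (k := tower j) (U := U) hδ0 n'
  have e1 : stepSeq (tower j) δ U n / weight η (halfPow n) * weight η' (halfPow n) * ρ j ^ κ =
      stepSeq (tower j) δ U n * (weight η (halfPow n') / weight η (halfPow n) *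
      (weight η' (halfPow n) / weight η' (halfPow n'))) * ρ j ^ κ *
      (weight η' (halfPow n') / weight η (halfPow n')) := by
    field_simp
  change stepSeq (tower j) δ U n / weight η (halfPow n) * weight η' (halfPow n) * ρ j ^ κ ≤ _
  rw [e1, hprod]
  have r1 := Real.rpow_pos_of_pos (hρ0 j) β
  have r2 := Real.rpow_pos_of_pos (hρ0 j) (-e + κ * L)
  have r3 := Real.rpow_pos_of_pos (hρ0 j) κ
  have r4 : 0 ≤ ∏ i ∈ Finset.range L, ρ i ^ (entry η i - entry η' i) :=
    Finset.prod_nonneg fun i _ => Real.rpow_nonneg (hρ0 i).le _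
  calc _ ≤ (3 + j : ℝ) ^ β * ρ j ^ β * stepSeq (tower j) δ U n' * (P * ρ j ^ (-e + κ * L)) *
        ρ j ^ κ * (weight η' (halfPow n') / weight η (halfPow n')) := by
        gcongr
    _ = (3 + j : ℝ) ^ β * P * (stepSeq (tower j) δ U n' / weight η (halfPow n') *
        weight η' (halfPow n')) * (ρ j ^ β * ρ j ^ (-e + κ * L) * ρ j ^ κ) := by ring
    _ = _ := by rw [hexp, mul_one]

end

/-! ### Reductions and non-reductions between the relations -/

section

variable {α δ : ℝ} {η η' : List ℝ} {j : ℕ} {U V : Set ℕ} {φ ψ : I → ℝ≥0}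

theorem borelReducible_modFun (hf : IsGauge (modFun α η φ)) (hg : IsGauge (modFun α η' ψ)) (C : ℝ)
    (h : ∀ m n, m ≤ n → (φ (halfPow m) / weight η (halfPow m)) *
      (ψ (halfPow n) / weight η' (halfPow n)) ≤ C * ((φ (halfPow n) / weight η (halfPow n)) *
        (ψ (halfPow m) / weight η' (halfPow m)))) :
    BorelReducible (ERel (modFun α η φ)) (ERel (modFun α η' ψ)) := by
  refine borelReducible_of_almost_increasing hf hg C.toNNReal fun m n hmn => ?_
  rw [← NNReal.coe_le_coe]
  push_cast
  simp only [coe_modFun _ _ _ (halfPow_ne_zero _)]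
  have h1 := Real.rpow_nonneg (halfPow m).2.1 α
  have h2 := Real.rpow_nonneg (halfPow n).2.1 α
  have hw := weight_pos η (halfPow n)
  have hv := weight_pos η' (halfPow m)
  have h3 := Real.le_coe_toNNReal C
  calc _ = (halfPow m : ℝ) ^ α * (halfPow n : ℝ) ^ α * ((φ (halfPow m) / weight η (halfPow m)) *
      (ψ (halfPow n) / weight η' (halfPow n))) := by ring
    _ ≤ (halfPow m : ℝ) ^ α * (halfPow n : ℝ) ^ α * (C.toNNReal *
        ((φ (halfPow n) / weight η (halfPow n)) * (ψ (halfPow m) / weight η' (halfPow m)))) := by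
        refine mul_le_mul_of_nonneg_left ((h m n hmn).trans ?_) (mul_nonneg h1 h2)
        gcongr
    _ = _ := by ring

theorem exists_bound_of_borelReducible_modFun (hf : IsGauge (modFun α η φ))
    (hg : IsGauge (modFun α η' ψ))
    (h : BorelReducible (ERel (modFun α η φ)) (ERel (modFun α η' ψ))) :
    ∃ C : ℝ, 0 ≤ C ∧ ∀ n, ψ (halfPow n) / weight η' (halfPow n) ≤
      C * (φ (halfPow n) / weight η (halfPow n)) := by
  obtain ⟨C, hC⟩ := exists_le_mul_of_borelReducible hf hg h
  refine ⟨C, C.2, fun n => ?_⟩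
  have h1 := NNReal.coe_le_coe.2 (hC n)
  rw [NNReal.coe_mul, coe_modFun _ _ _ (halfPow_ne_zero _),
    coe_modFun _ _ _ (halfPow_ne_zero _)] at h1
  have h2 := Real.rpow_pos_of_pos (coe_pos_of_ne_zero (halfPow_ne_zero n)) α
  refine le_of_mul_le_mul_left ?_ h2
  calc _ = (halfPow n : ℝ) ^ α * ψ (halfPow n) / weight η' (halfPow n) := by ring
    _ ≤ _ := h1
    _ = _ := by ring

theorem baseFun_borelReducible_modFun (hα : 1 ≤ α) (hη : ∀ a ∈ η, a ∈ Set.Ico (0 : ℝ) 1)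
    (hδ : 0 < δ) (hδ1 : δ < 1) (hφ : Monotone φ)
    (hφU : ∀ n, (φ (halfPow n) : ℝ) = stepSeq (tower j) δ U n) :
    BorelReducible (ERel (baseFun α η)) (ERel (modFun α η φ)) := by
  have hf := isGauge_baseFun hα hη
  have hg := isGauge_modFun_of_stepSeq hα hη hδ hδ1 hφ hφU
  rw [baseFun_eq_modFun] at hf ⊢
  refine borelReducible_modFun hf hg 1 fun m n hmn => ?_
  have h1 : (φ (halfPow n) : ℝ) ≤ φ (halfPow m) := hφ (halfPow_antitone hmn)
  have hw := weight_pos η (halfPow n)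
  have hv := weight_pos η (halfPow m)
  calc _ = (φ (halfPow n) : ℝ) / (weight η (halfPow n) * weight η (halfPow m)) := by
        simp only [Pi.one_apply, NNReal.coe_one]
        field_simp
    _ ≤ (φ (halfPow m) : ℝ) / (weight η (halfPow n) * weight η (halfPow m)) := by gcongr
    _ = _ := by
        simp only [Pi.one_apply, NNReal.coe_one]
        field_simp

theorem modFun_borelReducible_baseFun (hα : 1 ≤ α) (hη : ∀ a ∈ η, a ∈ Set.Ico (0 : ℝ) 1)
    (hη' : ∀ a ∈ η', a ∈ Set.Ico (0 : ℝ) 1) (heq : ∀ i < j, entry η i = entry η' i)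
    (hlt : entry η j < entry η' j) (hδ : (2 : ℝ) ^ (entry η j - entry η' j) < δ) (hδ1 : δ < 1)
    (hφ : Monotone φ) (hφU : ∀ n, (φ (halfPow n) : ℝ) = stepSeq (tower j) δ U n) :
    BorelReducible (ERel (modFun α η φ)) (ERel (baseFun α η')) := by
  have hδ0 : 0 < δ := (Real.rpow_pos_of_pos (by norm_num) _).trans hδ
  have hf := isGauge_modFun_of_stepSeq hα hη hδ0 hδ1 hφ hφU
  have hg := isGauge_baseFun hα hη'
  rw [baseFun_eq_modFun] at hg ⊢
  obtain ⟨C, ε, hC, hε, h⟩ := exists_weight_ratio_bound hη hη' heq hlt hδ hδ1 U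
  refine borelReducible_modFun hf hg C fun m n hmn => ?_
  have hv := weight_pos η' (halfPow n)
  have hv' := weight_pos η' (halfPow m)
  have h0 : 0 ≤ stepSeq (tower j) δ U m / weight η (halfPow m) * weight η' (halfPow m) :=
    mul_nonneg (div_nonneg (stepSeq_pos hδ0 m).le (weight_pos η _).le) hv'.le
  have h1 := (le_mul_of_one_le_right h0 (Real.one_le_rpow (one_le_iterLog_div j
    (halfPow_ne_zero _) (halfPow_antitone hmn)) hε.le)).trans (h m n hmn)
  rw [hφU, hφU]
  simp only [Pi.one_apply, NNReal.coe_one]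
  calc _ = stepSeq (tower j) δ U m / weight η (halfPow m) * weight η' (halfPow m) /
        (weight η' (halfPow m) * weight η' (halfPow n)) := by field_simp
    _ ≤ C * (stepSeq (tower j) δ U n / weight η (halfPow n) * weight η' (halfPow n)) /
        (weight η' (halfPow m) * weight η' (halfPow n)) := by gcongr
    _ = _ := by field_simp

/-- A reduction would bound the quotient of `f_U` by the upper function, but that quotient is at
least a constant times a positive power of `t_j`, which is unbounded along `tower j`. -/
theorem not_baseFun_borelReducible_modFun (hα : 1 ≤ α) (hη : ∀ a ∈ η, a ∈ Set.Ico (0 : ℝ) 1)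
    (hη' : ∀ a ∈ η', a ∈ Set.Ico (0 : ℝ) 1) (heq : ∀ i < j, entry η i = entry η' i)
    (hlt : entry η j < entry η' j) (hδ : (2 : ℝ) ^ (entry η j - entry η' j) < δ) (hδ1 : δ < 1)
    (hφ : Monotone φ) (hφU : ∀ n, (φ (halfPow n) : ℝ) = stepSeq (tower j) δ U n) :
    ¬ BorelReducible (ERel (baseFun α η')) (ERel (modFun α η φ)) := by
  intro hred
  have hδ0 : 0 < δ := (Real.rpow_pos_of_pos (by norm_num) _).trans hδ
  have hf := isGauge_modFun_of_stepSeq hα hη hδ0 hδ1 hφ hφU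
  have hg := isGauge_baseFun hα hη'
  rw [baseFun_eq_modFun] at hg hred
  obtain ⟨C, ε, hC, hε, h⟩ := exists_weight_ratio_bound hη hη' heq hlt hδ hδ1 U
  obtain ⟨B, hB, hle⟩ := exists_bound_of_borelReducible_modFun hg hf hred
  set r₀ := stepSeq (tower j) δ U 0 / weight η (halfPow 0) * weight η' (halfPow 0) with hr₀
  have hr₀pos : 0 < r₀ :=
    mul_pos (div_pos (stepSeq_pos hδ0 0) (weight_pos η _)) (weight_pos η' _)
  have hbd : ∀ n, iterLog j (halfPow n) / iterLog j (halfPow 0) ≤ (C * B / r₀) ^ ε⁻¹ := by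
    intro n
    have h1 := h 0 n n.zero_le
    rw [← hr₀] at h1
    have h2 := hle n
    have hv := weight_pos η' (halfPow n)
    simp only [hφU, Pi.one_apply, NNReal.coe_one, mul_one_div] at h2
    rw [le_div_iff₀ hv] at h2
    have h0 : 0 ≤ iterLog j (halfPow n) / iterLog j (halfPow 0) :=
      (div_pos (iterLog_pos _ _) (iterLog_pos _ _)).le
    have h3 : (iterLog j (halfPow n) / iterLog j (halfPow 0)) ^ ε ≤ C * B / r₀ := by
      rw [le_div_iff₀ hr₀pos, mul_comm]
      exact h1.trans (mul_le_mul_of_nonneg_left h2 hC.le)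
    have h4 := Real.rpow_le_rpow (Real.rpow_nonneg h0 _) h3 (inv_pos.2 hε).le
    rwa [Real.rpow_rpow_inv h0 hε.ne'] at h4
  obtain ⟨m, hm⟩ := pow_unbounded_of_one_lt ((C * B / r₀) ^ ε⁻¹ * iterLog j (halfPow 0))
    (by norm_num : (1 : ℝ) < 2)
  have h1 := hbd (tower j m)
  rw [div_le_iff₀ (iterLog_pos _ _)] at h1
  have h2 := (iterLog_halfPow_tower j m).1
  have h3 : (2 : ℝ) ^ m ≤ 2 ^ (m + 1) := pow_le_pow_right₀ (by norm_num) m.le_succ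
  linarith

theorem blockStart_strictMono : StrictMono blockStart :=
  strictMono_nat_of_lt_succ fun l => by
    rw [blockStart]
    have := Nat.zero_le (l * blockStart l)
    omega

theorem block_finite (l : ℕ) : (block l).Finite := Set.finite_Ico _ _

/-- Jumps of `u_U` that are not jumps of `u_V` come from the finitely many blocks indexed by `U \
V`; if they number `|E|`, then `u_U / u_V` is increasing up to the factor `δ ^ (-|E|)`. -/
theorem modFun_borelReducible_modFun (hα : 1 ≤ α) (hη : ∀ a ∈ η, a ∈ Set.Ico (0 : ℝ) 1)
    (hδ : 0 < δ) (hδ1 : δ < 1) (hφ : Monotone φ) (hψ : Monotone ψ)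
    (hφU : ∀ n, (φ (halfPow n) : ℝ) = stepSeq (tower j) δ U n)
    (hψV : ∀ n, (ψ (halfPow n) : ℝ) = stepSeq (tower j) δ V n) (h : AlmostSubset U V) :
    BorelReducible (ERel (modFun α η φ)) (ERel (modFun α η ψ)) := by
  have hk := tower_strictMono j
  have hE : (⋃ l ∈ U \ V, block l).Finite := Set.Finite.biUnion h fun l _ => block_finite l
  set E := hE.toFinset with hEdef
  have hcard : ∀ m n, m ≤ n → (stepSet (tower j) U n).card + (stepSet (tower j) V m).card ≤
      E.card + (stepSet (tower j) U m).card + (stepSet (tower j) V n).card := by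
    intro m n hmn
    have h1 : stepSet (tower j) U n \ stepSet (tower j) U m ⊆
        E ∪ (stepSet (tower j) V n \ stepSet (tower j) V m) := by
      intro i hi
      rw [Finset.mem_sdiff, mem_stepSet hk, mem_stepSet hk] at hi
      obtain ⟨⟨⟨l, hl, hil⟩, hin⟩, hi2⟩ := hi
      have him : ¬ tower j i ≤ m := fun h => hi2 ⟨⟨l, hl, hil⟩, h⟩
      rw [Finset.mem_union, Finset.mem_sdiff, mem_stepSet hk, mem_stepSet hk]
      by_cases hlV : l ∈ V
      · exact Or.inr ⟨⟨⟨l, hlV, hil⟩, hin⟩, fun h => him h.2⟩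
      · refine Or.inl (hE.mem_toFinset.2 ?_)
        exact Set.mem_biUnion (show l ∈ U \ V from ⟨hl, hlV⟩) hil
    have h2 := (Finset.card_le_card h1).trans (Finset.card_union_le _ _)
    have h3 := Finset.card_sdiff_add_card_eq_card (stepSet_mono (U := U) hk hmn)
    have h4 := Finset.card_sdiff_add_card_eq_card (stepSet_mono (U := V) hk hmn)
    omega
  refine borelReducible_modFun (isGauge_modFun_of_stepSeq hα hη hδ hδ1 hφ hφU)
    (isGauge_modFun_of_stepSeq hα hη hδ hδ1 hψ hψV) (δ ^ E.card)⁻¹ fun m n hmn => ?_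
  have h1 : δ ^ E.card * (stepSeq (tower j) δ U m * stepSeq (tower j) δ V n) ≤
      stepSeq (tower j) δ U n * stepSeq (tower j) δ V m := by
    simp only [stepSeq_eq_pow hk (tower_zero_pos j), ← pow_add]
    refine pow_le_pow_of_le_one hδ.le hδ1.le ?_
    have := hcard m n hmn
    omega
  rw [hφU, hφU, hψV, hψV]
  have hw := weight_pos η (halfPow n)
  have hv := weight_pos η (halfPow m)
  have hp : 0 < δ ^ E.card := by positivity
  calc _ = (δ ^ E.card)⁻¹ * (δ ^ E.card * (stepSeq (tower j) δ U m * stepSeq (tower j) δ V n)) /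
        (weight η (halfPow m) * weight η (halfPow n)) := by field_simp
    _ ≤ (δ ^ E.card)⁻¹ * (stepSeq (tower j) δ U n * stepSeq (tower j) δ V m) /
        (weight η (halfPow m) * weight η (halfPow n)) := by gcongr
    _ = _ := by field_simp

/-- For `l` in `U \ V`, evaluate at the last threshold of `I_l`: `V` has made at most `a_l` jumps,
while `U` has made at least `|I_l| = 1 + l * a_l ≥ l + a_l`. So `u_V / u_U ≥ δ ^ (-l)`, against the
bound given by a reduction. -/
theorem almostSubset_of_borelReducible (hα : 1 ≤ α) (hη : ∀ a ∈ η, a ∈ Set.Ico (0 : ℝ) 1)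
    (hδ : 0 < δ) (hδ1 : δ < 1) (hφ : Monotone φ) (hψ : Monotone ψ)
    (hφU : ∀ n, (φ (halfPow n) : ℝ) = stepSeq (tower j) δ U n)
    (hψV : ∀ n, (ψ (halfPow n) : ℝ) = stepSeq (tower j) δ V n)
    (h : BorelReducible (ERel (modFun α η φ)) (ERel (modFun α η ψ))) : AlmostSubset U V := by
  by_contra hUV
  have hk := tower_strictMono j
  obtain ⟨C, hC, hle⟩ := exists_bound_of_borelReducible_modFun
    (isGauge_modFun_of_stepSeq hα hη hδ hδ1 hφ hφU)
    (isGauge_modFun_of_stepSeq hα hη hδ hδ1 hψ hψV) h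
  have hle' : ∀ n, stepSeq (tower j) δ V n ≤ C * stepSeq (tower j) δ U n := by
    intro n
    have h1 := hle n
    rw [hφU, hψV, ← mul_div_assoc] at h1
    exact (div_le_div_iff_of_pos_right (weight_pos η _)).1 h1
  have hinf : (U \ V).Infinite := hUV
  obtain ⟨L, hL⟩ := exists_pow_lt_of_lt_one (show 0 < (C + 1)⁻¹ by positivity) hδ1
  obtain ⟨l, hl, hLl⟩ := hinf.exists_gt L
  have hl1 : 1 ≤ blockStart l :=
    (Nat.succ_le_of_lt (lt_of_le_of_lt L.zero_le hLl)).trans (blockStart_strictMono.id_le l)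
  have hsucc : blockStart (l + 1) = blockStart l + 1 + l * blockStart l := rfl
  set n := tower j (blockStart (l + 1) - 1) with hn
  have hV : (stepSet (tower j) V n).card ≤ blockStart l := by
    refine (Finset.card_le_card (t := Finset.range (blockStart l)) fun m hm => ?_).trans
      (Finset.card_range _).le
    rw [mem_stepSet hk] at hm
    obtain ⟨⟨l', hl', hml'⟩, hmn⟩ := hm
    have h1 : m ≤ blockStart (l + 1) - 1 := hk.le_iff_le.1 hmn
    rw [Finset.mem_range]
    by_contra! h2
    rcases lt_trichotomy l' l with h3 | h3 | h3
    · have h4 : blockStart (l' + 1) ≤ blockStart l := blockStart_strictMono.monotone h3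
      have := hml'.2
      omega
    · exact hl.2 (h3 ▸ hl')
    · have h4 : blockStart (l + 1) ≤ blockStart l' := blockStart_strictMono.monotone h3
      have := hml'.1
      omega
  have hU : l + blockStart l ≤ (stepSet (tower j) U n).card := by
    have h1 : Finset.Ico (blockStart l) (blockStart (l + 1)) ⊆ stepSet (tower j) U n := by
      intro m hm
      rw [Finset.mem_Ico] at hm
      rw [mem_stepSet hk]
      exact ⟨⟨l, hl.1, hm⟩, hk.monotone (by omega)⟩
    have h2 := Finset.card_le_card h1
    rw [Nat.card_Ico, hsucc] at h2
    have h3 : l + blockStart l ≤ 1 + l * blockStart l := by nlinarith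
    omega
  have h1 := hle' n
  rw [stepSeq_eq_pow hk (tower_zero_pos j), stepSeq_eq_pow hk (tower_zero_pos j)] at h1
  have h2 : δ ^ blockStart l ≤ δ ^ (stepSet (tower j) V n).card :=
    pow_le_pow_of_le_one hδ.le hδ1.le hV
  have h3 : δ ^ (stepSet (tower j) U n).card ≤ δ ^ (l + blockStart l) :=
    pow_le_pow_of_le_one hδ.le hδ1.le hU
  have h4 : δ ^ blockStart l ≤ C * δ ^ l * δ ^ blockStart l := by
    rw [mul_assoc, ← pow_add]
    exact h2.trans (h1.trans (by gcongr))
  have h5 : 1 ≤ C * δ ^ l := by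
    have : 0 < δ ^ blockStart l := by positivity
    exact (le_mul_iff_one_le_left this).1 h4
  have h6 : δ ^ l ≤ δ ^ L := pow_le_pow_of_le_one hδ.le hδ1.le hLl.le
  have h7 : C * δ ^ l ≤ C * (C + 1)⁻¹ := by gcongr; exact h6.trans hL.le
  have h8 : C * (C + 1)⁻¹ < 1 := by
    rw [← div_eq_mul_inv, div_lt_one (by positivity)]
    linarith
  linarith

end

/-! ### Step functions and the main theorem -/

open Classical in
/-- The step function on `[0,1]` with value `u n` at the point `1/2^n`. -/
noncomputable def stepFun (u : ℕ → ℝ) (x : I) : ℝ≥0 :=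
  if h : ∃ n, halfPow n ≤ x then (u (Nat.find h)).toNNReal else 0

theorem stepFun_monotone {u : ℕ → ℝ} (hu : Antitone u) : Monotone (stepFun u) := by
  intro x y hxy
  unfold stepFun
  by_cases hx : ∃ n, halfPow n ≤ x
  · have hy : ∃ n, halfPow n ≤ y := hx.imp fun n hn => hn.trans hxy
    rw [dif_pos hx, dif_pos hy]
    exact Real.toNNReal_mono (hu (Nat.find_min' hy ((Nat.find_spec hx).trans hxy)))
  · rw [dif_neg hx]
    exact zero_le

theorem halfPow_le_halfPow_iff {m n : ℕ} : halfPow m ≤ halfPow n ↔ n ≤ m := by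
  refine ⟨fun h => ?_, fun h => halfPow_antitone h⟩
  rw [← Subtype.coe_le_coe, coe_halfPow, coe_halfPow,
    one_div_le_one_div (by positivity) (by positivity)] at h
  exact (pow_le_pow_iff_right₀ (by norm_num)).1 h

theorem stepFun_halfPow {u : ℕ → ℝ} (hu : ∀ n, 0 ≤ u n) (n : ℕ) :
    (stepFun u (halfPow n) : ℝ) = u n := by
  have h : ∃ m, halfPow m ≤ halfPow n := ⟨n, le_rfl⟩
  have h1 : Nat.find h = n := le_antisymm (Nat.find_min' h le_rfl)
    (halfPow_le_halfPow_iff.1 (Nat.find_spec h))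
  rw [stepFun, dif_pos h, h1, Real.coe_toNNReal _ (hu n)]

theorem mainTheorem4 (α : ℝ) (hα : 1 ≤ α) (η η' : List ℝ)
    (hη : ∀ a ∈ η, a ∈ Set.Ico (0 : ℝ) 1) (hη' : ∀ a ∈ η', a ∈ Set.Ico (0 : ℝ) 1)
    (hlex : LexLT η η') :
    IsBorelEquivalence (ERel (baseFun α η)) ∧
    IsBorelEquivalence (ERel (baseFun α η')) ∧
    (∀ (j₀ : ℕ) (_ : IsLeast {j | entry η j < entry η' j} j₀)
      (δ : ℝ) (_ : (2 : ℝ) ^ (entry η j₀ - entry η' j₀) < δ) (_ : δ < 1)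
      (φ : Set ℕ → I → ℝ≥0)
      (_ : ∀ U, Continuous (φ U)) (_ : ∀ U, Monotone (φ U))
      (_ : ∀ U n, (φ U (halfPow n) : ℝ) = stepSeq (tower j₀) δ U n),
      (∀ U, IsBorelEquivalence (ERel (modFun α η (φ U)))) ∧
      (∀ U V, AlmostSubset U V ↔
        BorelReducible (ERel (modFun α η (φ U))) (ERel (modFun α η (φ V)))) ∧
      (∀ U, BorelReducible (ERel (baseFun α η)) (ERel (modFun α η (φ U))) ∧
        StrictBorelReducible (ERel (modFun α η (φ U))) (ERel (baseFun α η')))) ∧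
    (∃ e : PowerModFin ↪o BorelEqRel (ℕ → I), ∀ p,
      BorelReducible (ERel (baseFun α η)) (e p).rel ∧
      StrictBorelReducible (e p).rel (ERel (baseFun α η'))) := by
  -- Stated for monotone `φ` with prescribed values at the points `2⁻ⁿ`, so that the embedding of
  -- `P(ω)/Fin` can use the explicit `stepFun`.
  have core : ∀ (j₀ : ℕ) (_ : ∀ i < j₀, entry η i = entry η' i) (_ : entry η j₀ < entry η' j₀)
      (δ : ℝ) (_ : (2 : ℝ) ^ (entry η j₀ - entry η' j₀) < δ) (_ : δ < 1)
      (φ : Set ℕ → I → ℝ≥0) (_ : ∀ U, Monotone (φ U))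
      (_ : ∀ U n, (φ U (halfPow n) : ℝ) = stepSeq (tower j₀) δ U n),
      (∀ U, IsBorelEquivalence (ERel (modFun α η (φ U)))) ∧
      (∀ U V, AlmostSubset U V ↔
        BorelReducible (ERel (modFun α η (φ U))) (ERel (modFun α η (φ V)))) ∧
      (∀ U, BorelReducible (ERel (baseFun α η)) (ERel (modFun α η (φ U))) ∧
        StrictBorelReducible (ERel (modFun α η (φ U))) (ERel (baseFun α η'))) := by
    intro j₀ heq hlt δ hδ hδ1 φ hφ hφU
    have hδ0 : 0 < δ := (Real.rpow_pos_of_pos (by norm_num) _).trans hδ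
    exact ⟨fun U => (isGauge_modFun_of_stepSeq hα hη hδ0 hδ1 (hφ U) (hφU U)).isBorelEquivalence,
      fun U V => ⟨modFun_borelReducible_modFun hα hη hδ0 hδ1 (hφ U) (hφ V) (hφU U) (hφU V),
        almostSubset_of_borelReducible hα hη hδ0 hδ1 (hφ U) (hφ V) (hφU U) (hφU V)⟩,
      fun U => ⟨baseFun_borelReducible_modFun hα hη hδ0 hδ1 (hφ U) (hφU U),
        modFun_borelReducible_baseFun hα hη hη' heq hlt hδ hδ1 (hφ U) (hφU U),
        not_baseFun_borelReducible_modFun hα hη hη' heq hlt hδ hδ1 (hφ U) (hφU U)⟩⟩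
  obtain ⟨j, heq, hlt⟩ := hlex
  refine ⟨(isGauge_baseFun hα hη).isBorelEquivalence, (isGauge_baseFun hα hη').isBorelEquivalence,
    fun j₀ hj₀ δ hδ hδ1 φ _ hφ hφU => ?_, ?_⟩
  · have hj : j₀ ≤ j := hj₀.2 hlt
    exact core j₀ (fun i hi => heq i (hi.trans_le hj)) hj₀.1 δ hδ hδ1 φ hφ hφU
  · obtain ⟨δ, hδ, hδ1⟩ := exists_between
      (Real.rpow_lt_one_of_one_lt_of_neg (by norm_num : (1 : ℝ) < 2) (sub_neg.2 hlt))
    have hδ0 : 0 < δ := (Real.rpow_pos_of_pos (by norm_num) _).trans hδ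
    obtain ⟨h1, h2, h3⟩ := core j heq hlt δ hδ hδ1 (fun U => stepFun (stepSeq (tower j) δ U))
      (fun U => stepFun_monotone (stepSeq_antitone hδ0 hδ1))
      (fun U n => stepFun_halfPow (fun n => (stepSeq_pos hδ0 n).le) n)
    -- A representative is chosen in each class; the equivalence for arbitrary `U`, `V` gives the
    -- order embedding directly.
    refine ⟨OrderEmbedding.ofMapLEIff (fun p => ⟨_, h1 (ofAntisymmetrization (· ≤ ·) p).carrier⟩)
      fun p q => ?_, fun p => h3 _⟩
    rw [← ofAntisymmetrization_le_ofAntisymmetrization_iff]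
    exact (h2 _ _).symm
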